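/- **Proposition 1.2.** Let $\mathfrak m\in\mathbb R$, let $p_t(x)=\frac1{2\pi t}e^{-|x|^2/(2t)}$ be the heat kernel on $\mathbb R^2$ ($t>0$), and let $\eta$ be a spatial white noise on $\mathbb R^2$ defined on a probability space $(\Omega,\mathcal F,\mathbb P)$, i.e. a random real tempered distribution such that, for every real Schwartz function $\varphi$, $\eta(\varphi)$ is a centred Gaussian random variable with variance $\int\varphi^2$. Put $p_t\star\eta(x)=\eta(p_t(x-\cdot))$ and, for functions $f$ on $\mathbb R^2$, $P^{(\mathfrak m)}_tf(x)=e^{\mathfrak m t}\int_{\mathbb R^2}p_t(x-y)f(y)\,dy$ for $t>0$, $P^{(\mathfrak m)}_0f=f$. For $\varepsilon\in(0,\frac12)$ and $\hat\lambda>0$ consider the McKean–Vlasov equation $$\partial_t\mathcal V_\varepsilon=\tfrac12\Delta\mathcal V_\varepsilon+\mathfrak m\,\mathcal V_\varepsilon-\frac{3}{\log\frac1\varepsilon}\,\mathbb E[\mathcal V_\varepsilon^2]\,\mathcal V_\varepsilon,\qquad \mathcal V_\varepsilon(0,\cdot)=\hat\lambda\,p_{\varepsilon^2}\star\eta(\cdot).\tag{1}$$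 A *solution* is a random field $v=(v(t,x))_{t\ge0,\,x\in\mathbb R^2}$ (each $v(t,x)$ measurable) such that, $\mathbb P$-almost surely, $v$ is smooth on $(0,\infty)\times\mathbb R^2$ and satisfies the equation there, is continuous on $[0,\infty)\times\mathbb R^2$ with the prescribed initial value, and, for all $T\in(0,\infty)$, the functions $x\mapsto\sup_{0\le s\le T}|v(s,x)|$ and $x\mapsto\sup_{0\le s\le T}\mathbb E[v^2(s,x)]$ belong to $\mathcal E$, where $f\in\mathcal E$ means that $\sup_{x}|f(x)|e^{-\lambda|x|}<\infty$ for some $\lambda>0$. Then, for every $\hat\lambda>0$: 1. For every $\varepsilon\in(0,\frac12)$ equation (1) has a unique solution, where uniqueness means that any two solutions agree, $\mathbb P$-almost surely, at all $(t,x)\in[0,\infty)\times\mathbb R^2$ simultaneously. The solution is $$\mathcal V_\varepsilon(t,x)=\hat\lambda\,\sigma_{\hat\lambda,\varepsilon}(t)\,P^{(\mathfrak m)}_t(p_{\varepsilon^2}\star\eta)(x),\qquad \sigma_{\hat\lambda,\varepsilon}(t)=\Big(1+\frac{3\hat\lambda^2}{\pi}\,c_\varepsilon(t)\Big)^{-1/2},\qquad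 c_\varepsilon(t)=\frac1{2\log\frac1\varepsilon}\int_0^t\frac{e^{2\mathfrak m s}}{s+\varepsilon^2}\,ds .$$ 2. The function $\sigma(\zeta)=(1+\frac3\pi\zeta)^{-1/2}$ satisfies $\frac{d}{d\zeta}\sigma=-\frac3{2\pi}\sigma^3$ for $\zeta\ge0$ and $\sigma(0)=1$, and with $\sigma_{\hat\lambda}:=\sigma(\hat\lambda^2)=(1+\frac3\pi\hat\lambda^2)^{-1/2}$, $$\lim_{\varepsilon\to0}\mathbb E\Big[\big|\mathcal V_\varepsilon(t,x)-\hat\lambda\,\sigma_{\hat\lambda}\,e^{\mathfrak m t}\,p_t\star\eta(x)\big|^2\Big]=0\qquad\text{for all }(t,x)\in(0,\infty)\times\mathbb R^2 .$$ -/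

import Mathlib

open Real Set Filter Topology MeasureTheory ProbabilityTheory
open scoped NNReal ENNReal SchwartzMap Laplacian

noncomputable section

namespace MeanFieldAllenCahn

/-- The plane `ℝ²` with its Euclidean norm. -/
abbrev Plane : Type := EuclideanSpace ℝ (Fin 2)

/-- The heat kernel `p_t(z) = (2πt)⁻¹ exp(-|z|²/(2t))` on the plane (used for `t > 0` only). -/
def heatKernel (t : ℝ) (z : Plane) : ℝ :=
  1 / (2 * π * t) * Real.exp (-‖z‖ ^ 2 / (2 * t))

theorem heatKernel_contDiff (t : ℝ) (x : Plane) :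
    ContDiff ℝ (⊤ : ℕ∞) (fun y : Plane => heatKernel t (x - y)) := by
  unfold heatKernel
  have h : ContDiff ℝ (⊤ : ℕ∞) (fun y : Plane => ‖x - y‖ ^ 2) :=
    (contDiff_const.sub contDiff_id).norm_sq ℝ
  exact contDiff_const.mul ((h.neg.div_const _).exp)

/-- Every Gaussian `exp(-a|z|²)`, `a > 0`, has rapidly decreasing derivatives. -/
theorem gaussian_decay (a : ℝ) (ha : 0 < a) (k n : ℕ) :
    ∃ C : ℝ, ∀ z : Plane,
      ‖z‖ ^ k * ‖iteratedFDeriv ℝ n (fun z : Plane => Real.exp (-a * ‖z‖ ^ 2)) z‖ ≤ C := by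
  have hT : Function.HasTemperateGrowth (fun z : Plane => -a * ‖z‖ ^ 2) := by
    have : Function.HasTemperateGrowth (fun z : Plane => ‖z‖ ^ 2) := by fun_prop
    fun_prop
  obtain ⟨K, D, hD, hbd⟩ := hT.norm_iteratedFDeriv_le_uniform n
  set N : ℕ := k + K * n with hN
  refine ⟨n.factorial * (1 + D) ^ n * (N.factorial * Real.exp (1 + 1 / (4 * a))), fun z => ?_⟩
  have hz : (0 : ℝ) ≤ ‖z‖ := norm_nonneg z
  have h1 : (1 : ℝ) ≤ (1 + ‖z‖) ^ K := one_le_pow₀ (by linarith)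
  have key := norm_iteratedFDeriv_comp_le (𝕜 := ℝ) (g := Real.exp)
    (f := fun z : Plane => -a * ‖z‖ ^ 2) (n := n) (N := ((⊤ : ℕ∞) : WithTop ℕ∞))
    Real.contDiff_exp hT.1 (by exact_mod_cast le_top) z
    (C := Real.exp (-a * ‖z‖ ^ 2)) (D := (1 + D) * (1 + ‖z‖) ^ K)
    (by
      intro i _
      rw [norm_iteratedFDeriv_eq_norm_iteratedDeriv, iteratedDeriv_eq_iterate, Real.iter_deriv_exp]
      simp)
    (by
      intro i hi hin
      have h2 : (1 : ℝ) ≤ (1 + D) * (1 + ‖z‖) ^ K := by nlinarith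
      calc _ ≤ D * (1 + ‖z‖) ^ K := hbd i hin z
        _ ≤ (1 + D) * (1 + ‖z‖) ^ K := by nlinarith
        _ ≤ ((1 + D) * (1 + ‖z‖) ^ K) ^ i := le_self_pow₀ h2 (by omega))
  have h3 : (1 + ‖z‖) ^ N ≤ N.factorial * Real.exp (1 + ‖z‖) := by
    have := Real.pow_div_factorial_le_exp (1 + ‖z‖) (by linarith) N
    rw [div_le_iff₀ (by positivity)] at this
    linarith
  have h4 : Real.exp (1 + ‖z‖) * Real.exp (-a * ‖z‖ ^ 2) ≤ Real.exp (1 + 1 / (4 * a)) := by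
    rw [← Real.exp_add]
    apply Real.exp_le_exp.mpr
    have h5 : a * (‖z‖ - 1 / (2 * a)) ^ 2 = a * ‖z‖ ^ 2 - ‖z‖ + 1 / (4 * a) := by
      field_simp
      ring
    have h6 : 0 ≤ a * (‖z‖ - 1 / (2 * a)) ^ 2 := by positivity
    linarith
  calc _ ≤ (1 + ‖z‖) ^ k * (n.factorial * Real.exp (-a * ‖z‖ ^ 2) *
          ((1 + D) * (1 + ‖z‖) ^ K) ^ n) :=
        mul_le_mul (pow_le_pow_left₀ hz (by linarith) k) key (norm_nonneg _) (by positivity)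
    _ = n.factorial * (1 + D) ^ n * ((1 + ‖z‖) ^ N * Real.exp (-a * ‖z‖ ^ 2)) := by
        rw [hN, mul_pow, pow_add, pow_mul]; ring
    _ ≤ n.factorial * (1 + D) ^ n *
          (N.factorial * Real.exp (1 + ‖z‖) * Real.exp (-a * ‖z‖ ^ 2)) := by gcongr
    _ ≤ _ := by
        rw [mul_assoc (N.factorial : ℝ)]
        gcongr

/-- The centred Gaussian `exp(-a|z|²)`, `a > 0`, as a Schwartz function. -/
def gaussianSchwartz (a : ℝ) (ha : 0 < a) : 𝓢(Plane, ℝ) where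
  toFun z := Real.exp (-a * ‖z‖ ^ 2)
  smooth' := (contDiff_const.mul (contDiff_id.norm_sq ℝ)).exp
  decay' := gaussian_decay a ha

theorem heatKernel_decay (t : ℝ) (ht : 0 < t) (x : Plane) (k n : ℕ) :
    ∃ C : ℝ, ∀ y : Plane,
      ‖y‖ ^ k * ‖iteratedFDeriv ℝ n (fun y : Plane => heatKernel t (x - y)) y‖ ≤ C := by
  obtain ⟨C, hC⟩ := ((1 / (2 * π * t)) • SchwartzMap.compSubConstCLM ℝ x
    (gaussianSchwartz (1 / (2 * t)) (by positivity))).decay' k n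
  refine ⟨C, fun y => ?_⟩
  convert hC y using 4
  ext y
  simp only [heatKernel]
  change _ = 1 / (2 * π * t) * Real.exp (-(1 / (2 * t)) * ‖y - x‖ ^ 2)
  rw [norm_sub_rev]
  congr 2
  ring

/-- For `t > 0`, the Schwartz function `y ↦ p_t(x - y)`. -/
def heatTest (t : ℝ) (ht : 0 < t) (x : Plane) : 𝓢(Plane, ℝ) where
  toFun y := heatKernel t (x - y)
  smooth' := heatKernel_contDiff t x
  decay' := heatKernel_decay t ht x

/-- The convolution `(p_t ⋆ T)(x) = T(p_t(x - ·))` of the heat kernel at time `t > 0` with a real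
tempered distribution `T` (set to zero for `t ≤ 0`, where it is never used). -/
def heatConv (T : 𝓢(Plane, ℝ) →L[ℝ] ℝ) (t : ℝ) (x : Plane) : ℝ :=
  if ht : 0 < t then T (heatTest t ht x) else 0

/-- The heat semigroup with mass `m` acting on functions:
`P_0 f = f`, and `P_t f (x) = e^{mt} ∫ p_t(x - y) f(y) dy` for `t > 0`. -/
def heatSemigroup (m t : ℝ) (f : Plane → ℝ) (x : Plane) : ℝ :=
  if t = 0 then f x else Real.exp (m * t) * ∫ y, heatKernel t (x - y) * f y

/-- Spatial white noise on the plane: a random real tempered distribution `η` such that for every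
real Schwartz function `φ` the random variable `η(φ)` is centred Gaussian with variance `∫ φ²`.
Since `η` is linear, it follows that `(η(φ))_φ` is a centred Gaussian family and, by polarisation,
that `E[η(φ) η(ψ)] = ∫ φ ψ`, that is `E[η(x) η(y)] = δ(x - y)`. -/
def IsWhiteNoise {Ω : Type*} [MeasurableSpace Ω] (P : Measure Ω)
    (η : Ω → (𝓢(Plane, ℝ) →L[ℝ] ℝ)) : Prop :=
  ∀ φ : 𝓢(Plane, ℝ), HasLaw (fun ω => η ω φ) (gaussianReal 0 (∫ x, φ x ^ 2).toNNReal) P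

/-- At most exponential growth: `sup_x f(x) e^{-l|x|} < ∞` for some `l > 0`. -/
def ExpGrowth (f : Plane → ℝ≥0∞) : Prop :=
  ∃ l : ℝ, 0 < l ∧ ⨆ x, f x * ENNReal.ofReal (Real.exp (-l * ‖x‖)) < ⊤

/-- The random field `v t x ω`, `t ≥ 0`, is a solution to the McKean-Vlasov equation
`∂_t v = ½ Δ v + m v - α E[v²] v` with `v(0, ·) = v₀`.
The fields `growth` and `moment_growth` say that `x ↦ sup_{0 ≤ s ≤ T} |v(s, x)|` and
`x ↦ sup_{0 ≤ s ≤ T} E[v²(s, x)]` grow at most exponentially; in particular, by the latter and by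
measurability, `v(t, x)` is square integrable, so that the expectation in the equation is a genuine
one. The initial datum is attained continuously. -/
structure IsSolution {Ω : Type*} [MeasurableSpace Ω] (P : Measure Ω) (m α : ℝ)
    (v₀ : Plane → Ω → ℝ) (v : ℝ → Plane → Ω → ℝ) : Prop where
  aemeasurable : ∀ t : ℝ, 0 ≤ t → ∀ x : Plane, AEMeasurable (v t x) P
  initial : ∀ᵐ ω ∂P, ∀ x : Plane, v 0 x ω = v₀ x ω
  continuous : ∀ᵐ ω ∂P,
    ContinuousOn (fun q : ℝ × Plane => v q.1 q.2 ω) (Ici 0 ×ˢ univ)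
  smooth : ∀ᵐ ω ∂P,
    ContDiffOn ℝ (⊤ : ℕ∞) (fun q : ℝ × Plane => v q.1 q.2 ω) (Ioi 0 ×ˢ univ)
  equation : ∀ᵐ ω ∂P, ∀ t : ℝ, 0 < t → ∀ x : Plane,
    deriv (fun s => v s x ω) t =
      1 / 2 * (Δ (fun y => v t y ω)) x + m * v t x ω - α * (∫ ω', v t x ω' ^ 2 ∂P) * v t x ω
  growth : ∀ᵐ ω ∂P, ∀ T : ℝ, 0 < T →
    ExpGrowth (fun x => ⨆ s ∈ Icc (0 : ℝ) T, ‖v s x ω‖ₑ)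
  moment_growth : ∀ T : ℝ, 0 < T →
    ExpGrowth (fun x => ⨆ s ∈ Icc (0 : ℝ) T, ∫⁻ ω, ‖v s x ω‖ₑ ^ 2 ∂P)

/-- `v` solves `∂_t v = ½ Δ v + m v - 3 (log 1/ε)⁻¹ E[v²] v` with `v(0, ·) = lam • (p_{ε²} ⋆ η)`. -/
def IsMcKeanVlasovSolution {Ω : Type*} [MeasurableSpace Ω] (P : Measure Ω)
    (η : Ω → (𝓢(Plane, ℝ) →L[ℝ] ℝ)) (m lam ε : ℝ) (v : ℝ → Plane → Ω → ℝ) : Prop :=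
  IsSolution P m (3 / Real.log (1 / ε)) (fun x ω => lam * heatConv (η ω) (ε ^ 2) x) v

/-- `σ(ζ) = (1 + 3ζ/π)^{-1/2}`. -/
def sigma (ζ : ℝ) : ℝ := 1 / √(1 + 3 / π * ζ)

/-- `c_ε(t) = (2 log(1/ε))⁻¹ ∫₀ᵗ e^{2ms} / (s + ε²) ds`. -/
def cEps (m ε t : ℝ) : ℝ :=
  1 / (2 * Real.log (1 / ε)) * ∫ s in (0 : ℝ)..t, Real.exp (2 * m * s) / (s + ε ^ 2)

/-- `σ_{lam,ε}(t) = (1 + (3 lam²/π) c_ε(t))^{-1/2}`. -/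
def sigmaEps (m lam ε t : ℝ) : ℝ := 1 / √(1 + 3 * lam ^ 2 / π * cEps m ε t)

/-- The explicit random field `lam σ_{lam,ε}(t) P_t^{(m)}(p_{ε²} ⋆ η)(x)`. -/
def explicitSolution {Ω : Type*} (η : Ω → (𝓢(Plane, ℝ) →L[ℝ] ℝ)) (m lam ε t : ℝ) (x : Plane)
    (ω : Ω) : ℝ :=
  lam * sigmaEps m lam ε t * heatSemigroup m t (heatConv (η ω) (ε ^ 2)) x

end MeanFieldAllenCahn

end

open Real Set Filter Topology MeasureTheory ProbabilityTheory
open scoped NNReal ENNReal SchwartzMap Laplacian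

noncomputable section

namespace MeanFieldAllenCahn

/-! ### Gaussian integrals on the plane -/

/-! The second moment in the equation is deterministic, so each path of a solution solves a linear
heat equation with a nonnegative potential.

Existence. Write `P_t` for the massless heat semigroup. Almost surely at each point, `P_t (p_{ε²} ⋆
η) = p_{t+ε²} ⋆ η` (`IsWhiteNoise.heatSemigroup_heatConv`), and the variance of this field is
`p_{2(t+ε²)}(0) = 1/(4π(t+ε²))`, independent of `x`. For a field `a(t) P_t (p_{ε²} ⋆ η)` the
equation thus reduces to the Bernoulli equation `a' = m a - 3 a³ / (4π (t+ε²) log(1/ε))`, which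
`amplitude` solves (`hasDerivAt_amplitude`). The regularity needed comes from writing the heat
semigroup as an integral of exponentials of linear functions of suitable parameters
(`contDiffOn_heatSemigroup`).

Uniqueness. By the maximum principle every solution is bounded pathwise by a field `Z`, the solution
of the linear equation with initial value `|v(0,·)|`, and `E[Z²] ≤ D` uniformly in space and on
bounded time intervals. If two solutions satisfy `|v - u| ≤ b Z`, their second moments differ by at
most `2 b D`. Comparing pathwise once more improves `b(t)` to `2 α D ∫₀ᵗ b`
(`IsSpaceTimeRegular.sub_le_of_potential_close`). Starting from `b = 2`, the iterates are `2 (κ t)ⁿ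
/ n!` with `κ = 2 α D`, and they tend to zero.

Limit. Since `∫₀ᵗ ds/(s+ε²) = log(t+ε²) + 2 log(1/ε)` and the factor `e^{2ms}` changes the integral
only by a bounded amount, `c_ε(t) → 1`. The mean square error is an explicit combination of three
heat kernel values at the origin, which cancel in the limit. -/

theorem integrable_exp_neg_mul_norm_sq {a : ℝ} (ha : 0 < a) :
    Integrable (fun y : Plane => Real.exp (-a * ‖y‖ ^ 2)) := by
  have h := (GaussianFourier.integrable_cexp_neg_mul_sq_norm_add (b := (a : ℂ)) (V := Plane)
    (by simpa using ha) 0 0).norm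
  refine h.congr (ae_of_all _ fun y => ?_)
  simp only [Complex.norm_exp]
  norm_num [← Complex.ofReal_pow]

theorem integral_exp_neg_mul_norm_sq {a : ℝ} (ha : 0 < a) :
    ∫ y : Plane, Real.exp (-a * ‖y‖ ^ 2) = π / a := by
  rw [GaussianFourier.integral_rexp_neg_mul_sq_norm ha]
  simp

/-- Half of the Gaussian absorbs the linear term, as `l‖y‖ ≤ (a/2)‖y‖² + l²/(2a)`. -/
theorem integrable_exp_neg_mul_norm_sq_add {a : ℝ} (ha : 0 < a) (l : ℝ) :
    Integrable (fun y : Plane => Real.exp (-a * ‖y‖ ^ 2 + l * ‖y‖)) := by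
  refine ((integrable_exp_neg_mul_norm_sq (half_pos ha)).const_mul
    (Real.exp (l ^ 2 / (2 * a)))).mono' (by fun_prop) (ae_of_all _ fun y => ?_)
  rw [Real.norm_eq_abs, Real.abs_exp, ← Real.exp_add]
  apply Real.exp_le_exp.mpr
  have h : a / 2 * (‖y‖ - l / a) ^ 2 = a / 2 * ‖y‖ ^ 2 - l * ‖y‖ + l ^ 2 / (2 * a) := by
    field_simp
    ring
  have h2 : 0 ≤ a / 2 * (‖y‖ - l / a) ^ 2 := by positivity
  linarith

theorem heatKernel_pos {t : ℝ} (ht : 0 < t) (z : Plane) : 0 < heatKernel t z := by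
  unfold heatKernel
  positivity

theorem heatKernel_neg (t : ℝ) (z : Plane) : heatKernel t (-z) = heatKernel t z := by
  simp [heatKernel]

theorem heatKernel_sub_comm (t : ℝ) (x y : Plane) :
    heatKernel t (x - y) = heatKernel t (y - x) := by
  rw [← neg_sub, heatKernel_neg]

@[fun_prop]
theorem continuous_heatKernel (t : ℝ) : Continuous (heatKernel t) := by
  unfold heatKernel
  fun_prop

theorem heatKernel_eq (t : ℝ) (z : Plane) :
    heatKernel t z = 1 / (2 * π * t) * Real.exp (-(1 / (2 * t)) * ‖z‖ ^ 2) := by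
  rw [heatKernel]
  ring_nf

theorem integrable_heatKernel {t : ℝ} (ht : 0 < t) : Integrable (heatKernel t) := by
  have := (integrable_exp_neg_mul_norm_sq (a := 1 / (2 * t)) (by positivity)).const_mul
    (1 / (2 * π * t))
  exact this.congr (ae_of_all _ fun y => (heatKernel_eq t y).symm)

theorem integral_heatKernel {t : ℝ} (ht : 0 < t) : ∫ y, heatKernel t y = 1 := by
  simp_rw [heatKernel_eq]
  rw [integral_const_mul, integral_exp_neg_mul_norm_sq (by positivity)]
  field_simp

theorem integrable_heatKernel_sub {t : ℝ} (ht : 0 < t) (x : Plane) :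
    Integrable (fun y => heatKernel t (x - y)) :=
  (integrable_heatKernel ht).comp_sub_left x

theorem integral_heatKernel_sub {t : ℝ} (ht : 0 < t) (x : Plane) :
    ∫ y, heatKernel t (x - y) = 1 := by
  rw [integral_sub_left_eq_self (heatKernel t), integral_heatKernel ht]

/-- Completing the square in `y` isolates a heat kernel centred at the weighted mean of `x` and `z`,
so integrating over `y` only uses its total mass. -/
theorem heatKernel_mul_heatKernel {s t : ℝ} (hs : 0 < s) (ht : 0 < t) (x y z : Plane) :
    heatKernel s (x - y) * heatKernel t (y - z) =
      heatKernel (s + t) (x - z) *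
        heatKernel (s * t / (s + t)) (y - ((t / (s + t)) • x + (s / (s + t)) • z)) := by
  have hst : 0 < s + t := by positivity
  set p := x - y with hp
  set q := y - z with hq
  have e1 : x - z = p + q := by rw [hp, hq]; abel
  have e2 : y - ((t / (s + t)) • x + (s / (s + t)) • z) =
      (s / (s + t)) • q - (t / (s + t)) • p := by
    have : y = (t / (s + t)) • y + (s / (s + t)) • y := by
      rw [← add_smul, ← add_div, add_comm t s, div_self hst.ne', one_smul]
    rw [hp, hq]
    nth_rw 1 [this]
    simp only [smul_sub]
    abel
  have e3 : ‖p + q‖ ^ 2 = ‖p‖ ^ 2 + 2 * inner ℝ p q + ‖q‖ ^ 2 := norm_add_sq_real p q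
  have e4 : ‖(s / (s + t)) • q - (t / (s + t)) • p‖ ^ 2 =
      (s / (s + t)) ^ 2 * ‖q‖ ^ 2 - 2 * (s / (s + t)) * (t / (s + t)) * inner ℝ p q
        + (t / (s + t)) ^ 2 * ‖p‖ ^ 2 := by
    rw [norm_sub_sq_real, norm_smul, norm_smul, inner_smul_left, inner_smul_right,
      real_inner_comm q p, mul_pow, mul_pow, Real.norm_eq_abs, Real.norm_eq_abs, sq_abs, sq_abs]
    simp
    ring
  unfold heatKernel
  rw [e1, e2, e3, e4, mul_mul_mul_comm, mul_mul_mul_comm (1 / (2 * π * (s + t))), ← Real.exp_add,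
    ← Real.exp_add]
  congr 1
  · field_simp
  · congr 1
    field_simp
    ring

/-- The Chapman-Kolmogorov equation. -/
theorem integral_heatKernel_mul_heatKernel {s t : ℝ} (hs : 0 < s) (ht : 0 < t) (x z : Plane) :
    ∫ y, heatKernel s (x - y) * heatKernel t (y - z) = heatKernel (s + t) (x - z) := by
  simp_rw [heatKernel_mul_heatKernel hs ht]
  rw [integral_const_mul, integral_sub_right_eq_self (heatKernel (s * t / (s + t))),
    integral_heatKernel (by positivity), mul_one]

theorem heatKernel_zero (t : ℝ) : heatKernel t 0 = 1 / (2 * π * t) := by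
  simp [heatKernel]

/-! ### Smoothness of exponential integrals -/

section ExpIntegral

variable {Y : Type*} [MeasurableSpace Y] {μ : Measure Y}

/-- Differentiation under the integral when the exponent is linear in the parameter. A little extra
exponential integrability, measured by `r`, dominates the derivative near `q₀`. -/
theorem integrable_exp_smul_and_smulRight {E V : Type*} [NormedAddCommGroup E] [NormedSpace ℝ E]
    [NormedAddCommGroup V] [NormedSpace ℝ V]
    {ℓ : Y → E →L[ℝ] ℝ} {g : Y → V} (hℓ : AEStronglyMeasurable ℓ μ)
    (hg : AEStronglyMeasurable g μ) {q₀ : E} {r : ℝ} (hr : 0 < r)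
    (h : Integrable (fun y => Real.exp (ℓ y q₀ + r * ‖ℓ y‖) * ‖g y‖) μ) :
    Integrable (fun y => Real.exp (ℓ y q₀) • g y) μ ∧
      Integrable (fun y => Real.exp (ℓ y q₀) • (ℓ y).smulRight (g y)) μ ∧
      HasFDerivAt (fun q => ∫ y, Real.exp (ℓ y q) • g y ∂μ)
        (∫ y, Real.exp (ℓ y q₀) • (ℓ y).smulRight (g y) ∂μ) q₀ := by
  have hexp : ∀ q : E, AEStronglyMeasurable (fun y => Real.exp (ℓ y q)) μ := fun q =>
    Real.continuous_exp.comp_aestronglyMeasurable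
      ((ContinuousLinearMap.apply ℝ ℝ q).continuous.comp_aestronglyMeasurable hℓ)
  have hmeas : ∀ q : E, AEStronglyMeasurable (fun y => Real.exp (ℓ y q) • g y) μ :=
    fun q => (hexp q).smul hg
  have hright : AEStronglyMeasurable (fun y => (ℓ y).smulRight (g y)) μ :=
    (ContinuousLinearMap.smulRightL ℝ E V).aestronglyMeasurable_comp₂ hℓ hg
  have hmeas' : AEStronglyMeasurable (fun y => Real.exp (ℓ y q₀) • (ℓ y).smulRight (g y)) μ :=
    (hexp q₀).smul hright
  have hint : Integrable (fun y => Real.exp (ℓ y q₀) • g y) μ := by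
    refine h.mono' (hmeas q₀) (ae_of_all _ fun y => ?_)
    rw [norm_smul, Real.norm_eq_abs, Real.abs_exp]
    gcongr
    have := norm_nonneg (ℓ y)
    nlinarith
  -- Half of the margin `r` pays for moving `q` within the ball, the other half for the factor `‖ℓ
  -- y‖` produced by the derivative.
  have hbd : ∀ y, ∀ q ∈ Metric.ball q₀ (r / 2),
      ‖Real.exp (ℓ y q) • (ℓ y).smulRight (g y)‖ ≤
        2 / r * (Real.exp (ℓ y q₀ + r * ‖ℓ y‖) * ‖g y‖) := by
    intro y q hq
    rw [norm_smul, Real.norm_eq_abs, Real.abs_exp, ContinuousLinearMap.norm_smulRight_apply]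
    have h1 : ℓ y q ≤ ℓ y q₀ + r / 2 * ‖ℓ y‖ := by
      have h2 : ℓ y (q - q₀) ≤ ‖ℓ y‖ * ‖q - q₀‖ :=
        (le_abs_self _).trans ((ℓ y).le_opNorm _)
      have h3 : ‖q - q₀‖ ≤ r / 2 := (mem_ball_iff_norm.mp hq).le
      have h4 : ‖ℓ y‖ * ‖q - q₀‖ ≤ ‖ℓ y‖ * (r / 2) := by gcongr
      rw [map_sub] at h2
      linarith
    have h5 : ‖ℓ y‖ ≤ 2 / r * Real.exp (r / 2 * ‖ℓ y‖) := by
      have h6 : r / 2 * ‖ℓ y‖ ≤ Real.exp (r / 2 * ‖ℓ y‖) :=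
        (by linarith : r / 2 * ‖ℓ y‖ ≤ r / 2 * ‖ℓ y‖ + 1).trans (Real.add_one_le_exp _)
      calc ‖ℓ y‖ = 2 / r * (r / 2 * ‖ℓ y‖) := by field_simp
        _ ≤ _ := by gcongr
    calc Real.exp (ℓ y q) * (‖ℓ y‖ * ‖g y‖)
        ≤ Real.exp (ℓ y q₀ + r / 2 * ‖ℓ y‖) * (2 / r * Real.exp (r / 2 * ‖ℓ y‖) * ‖g y‖) := by
          gcongr
      _ = 2 / r * ((Real.exp (ℓ y q₀ + r / 2 * ‖ℓ y‖) * Real.exp (r / 2 * ‖ℓ y‖)) * ‖g y‖) := by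
          ring
      _ = _ := by rw [← Real.exp_add]; ring_nf
  refine ⟨hint, ?_, ?_⟩
  · exact (h.const_mul (2 / r)).mono' hmeas'
      (ae_of_all _ fun y => hbd y q₀ (Metric.mem_ball_self (by positivity)))
  · refine hasFDerivAt_integral_of_dominated_of_fderiv_le
      (F' := fun q y => Real.exp (ℓ y q) • (ℓ y).smulRight (g y))
      (Metric.ball_mem_nhds q₀ (by positivity : 0 < r / 2)) (Eventually.of_forall hmeas) hint
      hmeas' (ae_of_all _ hbd) (h.const_mul _) (ae_of_all _ fun y q _ => ?_)
    have h1 : HasFDerivAt (fun q => Real.exp (ℓ y q)) (Real.exp (ℓ y q) • ℓ y) q :=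
      (ℓ y).hasFDerivAt.exp
    convert h1.smul_const (g y) using 1
    ext v
    simp [smul_smul, mul_comm]

/-- The derivative is an integral of the same kind, with `g` replaced by `(ℓ y).smulRight (g y)` and
the margin halved. The target space therefore changes at each induction step; `E` and `V` lie in
`Type` so that `E →L[ℝ] V` does too. -/
theorem contDiffOn_integral_exp_smul {E : Type} [NormedAddCommGroup E] [NormedSpace ℝ E]
    {ℓ : Y → E →L[ℝ] ℝ} (hℓ : AEStronglyMeasurable ℓ μ) {U : Set E} (hU : IsOpen U) (n : ℕ) :
    ∀ {V : Type} [NormedAddCommGroup V] [NormedSpace ℝ V] {g : Y → V},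
      AEStronglyMeasurable g μ →
      (∀ q ∈ U, ∃ r : ℝ, 0 < r ∧
        Integrable (fun y => Real.exp (ℓ y q + r * ‖ℓ y‖) * ‖g y‖) μ) →
      ContDiffOn ℝ n (fun q => ∫ y, Real.exp (ℓ y q) • g y ∂μ) U := by
  induction n with
  | zero =>
    intro V _ _ g hg h
    refine contDiffOn_zero.mpr fun q hq => ?_
    obtain ⟨r, hr, hi⟩ := h q hq
    exact (integrable_exp_smul_and_smulRight hℓ hg hr hi).2.2.continuousAt.continuousWithinAt
  | succ n ih =>
    intro V _ _ g hg h
    have hder : ∀ q ∈ U, HasFDerivAt (fun q => ∫ y, Real.exp (ℓ y q) • g y ∂μ)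
        (∫ y, Real.exp (ℓ y q) • (ℓ y).smulRight (g y) ∂μ) q := fun q hq => by
      obtain ⟨r, hr, hi⟩ := h q hq
      exact (integrable_exp_smul_and_smulRight hℓ hg hr hi).2.2
    have hright : AEStronglyMeasurable (fun y => (ℓ y).smulRight (g y)) μ :=
      (ContinuousLinearMap.smulRightL ℝ E V).aestronglyMeasurable_comp₂ hℓ hg
    push_cast
    refine (contDiffOn_succ_iff_fderiv_of_isOpen hU).mpr
      ⟨fun q hq => (hder q hq).differentiableAt.differentiableWithinAt, by simp, ?_⟩
    refine (ih hright fun q hq => ?_).congr fun q hq => (hder q hq).fderiv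
    obtain ⟨r, hr, hi⟩ := h q hq
    refine ⟨r / 2, by positivity, (hi.const_mul (2 / r)).mono' ?_ (ae_of_all _ fun y => ?_)⟩
    · refine AEStronglyMeasurable.mul (Real.continuous_exp.comp_aestronglyMeasurable
        (((ContinuousLinearMap.apply ℝ ℝ q).continuous.comp_aestronglyMeasurable hℓ).add
          (hℓ.norm.const_mul _))) hright.norm
    · rw [norm_mul, norm_norm, Real.norm_eq_abs, Real.abs_exp,
        ContinuousLinearMap.norm_smulRight_apply]
      have h5 : ‖ℓ y‖ ≤ 2 / r * Real.exp (r / 2 * ‖ℓ y‖) := by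
        have h6 : r / 2 * ‖ℓ y‖ ≤ Real.exp (r / 2 * ‖ℓ y‖) :=
          (by linarith : r / 2 * ‖ℓ y‖ ≤ r / 2 * ‖ℓ y‖ + 1).trans (Real.add_one_le_exp _)
        calc ‖ℓ y‖ = 2 / r * (r / 2 * ‖ℓ y‖) := by field_simp
          _ ≤ _ := by gcongr
      calc Real.exp (ℓ y q + r / 2 * ‖ℓ y‖) * (‖ℓ y‖ * ‖g y‖)
          ≤ Real.exp (ℓ y q + r / 2 * ‖ℓ y‖) * (2 / r * Real.exp (r / 2 * ‖ℓ y‖) * ‖g y‖) := by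
            gcongr
        _ = 2 / r * ((Real.exp (ℓ y q + r / 2 * ‖ℓ y‖) * Real.exp (r / 2 * ‖ℓ y‖)) * ‖g y‖) := by
            ring
        _ = _ := by rw [← Real.exp_add]; ring_nf

theorem hasDerivAt_integral_exp_mul {c g : Y → ℝ} (hc : AEStronglyMeasurable c μ)
    (hg : AEStronglyMeasurable g μ) {q₀ r : ℝ} (hr : 0 < r)
    (h : Integrable (fun y => Real.exp (q₀ * c y + r * |c y|) * |g y|) μ) :
    HasDerivAt (fun q => ∫ y, Real.exp (q * c y) * g y ∂μ)
      (∫ y, Real.exp (q₀ * c y) * (c y * g y) ∂μ) q₀ := by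
  set ℓ : Y → ℝ →L[ℝ] ℝ := fun y => ContinuousLinearMap.toSpanSingleton ℝ (c y) with hℓdef
  have hℓ : AEStronglyMeasurable ℓ μ :=
    (ContinuousLinearMap.toSpanSingletonCLE (𝕜 := ℝ) (E := ℝ)).continuous.comp_aestronglyMeasurable
      hc
  have hn : ∀ y, ‖ℓ y‖ = |c y| := fun y => by
    rw [hℓdef, ContinuousLinearMap.norm_toSpanSingleton, Real.norm_eq_abs]
  have hv : ∀ y q, ℓ y q = q * c y := fun y q => by simp [hℓdef]
  have key := integrable_exp_smul_and_smulRight (q₀ := q₀) hℓ hg hr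
    (h.congr (ae_of_all _ fun y => by simp only [hn, hv, Real.norm_eq_abs]))
  have := key.2.2.hasDerivAt
  rw [ContinuousLinearMap.integral_apply key.2.1] at this
  simpa [hv, smul_eq_mul] using this

end ExpIntegral

/-! ### Laplacian along coordinate lines -/

theorem deriv_deriv_comp_add_smul {φ : Plane → ℝ} {x : Plane} (h : ContDiffAt ℝ 2 φ x)
    (e : Plane) :
    deriv (deriv fun s : ℝ => φ (x + s • e)) 0 = iteratedFDeriv ℝ 2 φ x ![e, e] := by
  have hline : ∀ s : ℝ, HasDerivAt (fun s : ℝ => x + s • e) e s := fun s => by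
    simpa using ((hasDerivAt_id s).smul_const e).const_add x
  have h0 : x + (0 : ℝ) • e = x := by rw [zero_smul, add_zero]
  have hcont : Tendsto (fun s : ℝ => x + s • e) (𝓝 0) (𝓝 x) := by
    have h1 : ContinuousAt (fun s : ℝ => x + s • e) 0 := (hline 0).continuousAt
    rwa [ContinuousAt, h0] at h1
  have h1 : (deriv fun s : ℝ => φ (x + s • e)) =ᶠ[𝓝 0] fun s => fderiv ℝ φ (x + s • e) e := by
    filter_upwards [hcont.eventually (h.eventually (by simp))] with s hs
    exact ((hs.differentiableAt (by simp)).hasFDerivAt.comp_hasDerivAt s (hline s)).deriv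
  have h2 : HasFDerivAt (fderiv ℝ φ) (fderiv ℝ (fderiv ℝ φ) x) (x + (0 : ℝ) • e) := by
    rw [h0]
    exact ((h.fderiv_right (m := 1) (by norm_num)).differentiableAt (by simp)).hasFDerivAt
  have h3 : HasDerivAt (fun s : ℝ => fderiv ℝ φ (x + s • e))
      (fderiv ℝ (fderiv ℝ φ) x e) 0 := h2.comp_hasDerivAt (0 : ℝ) (hline 0)
  have h4 : HasDerivAt (fun s : ℝ => fderiv ℝ φ (x + s • e) e)
      (fderiv ℝ (fderiv ℝ φ) x e e) 0 :=
    (ContinuousLinearMap.apply ℝ ℝ e).hasFDerivAt.comp_hasDerivAt (0 : ℝ) h3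
  rw [h1.deriv_eq, iteratedFDeriv_two_apply, h4.deriv]
  rfl

/-- Reduces both the heat equation and the sign of the Laplacian at a maximum to one-variable
calculus. -/
theorem laplacian_eq_sum_deriv_deriv {φ : Plane → ℝ} {x : Plane} (h : ContDiffAt ℝ 2 φ x) :
    (Δ φ) x = ∑ i : Fin 2,
      deriv (deriv fun s : ℝ => φ (x + s • EuclideanSpace.single i (1 : ℝ))) 0 := by
  rw [InnerProductSpace.laplacian_eq_iteratedFDeriv_orthonormalBasis φ
    (EuclideanSpace.basisFun (Fin 2) ℝ)]
  exact Finset.sum_congr rfl fun i _ => by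
    rw [deriv_deriv_comp_add_smul h, EuclideanSpace.basisFun_apply]

/-! ### The heat semigroup on functions of exponential growth -/

/-- `f` is bounded by a multiple of `exp (l ‖x‖)` for some `l`. -/
def ExpBounded (f : Plane → ℝ) : Prop :=
  ∃ C l : ℝ, 0 ≤ C ∧ 0 ≤ l ∧ ∀ x, |f x| ≤ C * Real.exp (l * ‖x‖)

theorem ExpBounded.abs {f : Plane → ℝ} (h : ExpBounded f) : ExpBounded (fun x => |f x|) := by
  obtain ⟨C, l, hC, hl, h⟩ := h
  exact ⟨C, l, hC, hl, fun x => by rw [abs_abs]; exact h x⟩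

/-- Continuous in time and space up to time zero, smooth at positive times, and of exponential
growth in space, locally uniformly in time. -/
structure IsSpaceTimeRegular (w : ℝ → Plane → ℝ) : Prop where
  continuousOn : ContinuousOn (fun q : ℝ × Plane => w q.1 q.2) (Ici 0 ×ˢ univ)
  contDiffOn : ContDiffOn ℝ (⊤ : ℕ∞) (fun q : ℝ × Plane => w q.1 q.2) (Ioi 0 ×ˢ univ)
  growth : ∀ T : ℝ, 0 < T → ∃ C l : ℝ, 0 ≤ C ∧ 0 ≤ l ∧
    ∀ t ∈ Icc 0 T, ∀ x, |w t x| ≤ C * Real.exp (l * ‖x‖)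

namespace IsSpaceTimeRegular

variable {w w' : ℝ → Plane → ℝ}

theorem contDiffAt (h : IsSpaceTimeRegular w) {t : ℝ} (ht : 0 < t) (x : Plane) :
    ContDiffAt ℝ (⊤ : ℕ∞) (fun q : ℝ × Plane => w q.1 q.2) (t, x) :=
  h.contDiffOn.contDiffAt ((isOpen_Ioi.prod isOpen_univ).mem_nhds (by simpa using ht))

theorem contDiffAt_space (h : IsSpaceTimeRegular w) {t : ℝ} (ht : 0 < t) (x : Plane) :
    ContDiffAt ℝ 2 (w t) x := by
  have h1 := contDiffAt_infty.mp (h.contDiffAt ht x) 2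
  exact h1.comp x (f := fun y : Plane => (t, y)) (by fun_prop)

theorem differentiableAt_time (h : IsSpaceTimeRegular w) {t : ℝ} (ht : 0 < t) (x : Plane) :
    DifferentiableAt ℝ (fun s => w s x) t := by
  have h1 := (h.contDiffAt ht x).differentiableAt (by simp)
  exact h1.comp t (f := fun s : ℝ => (s, x)) (by fun_prop)

theorem sub (h : IsSpaceTimeRegular w) (h' : IsSpaceTimeRegular w') :
    IsSpaceTimeRegular (fun t x => w t x - w' t x) where
  continuousOn := h.continuousOn.sub h'.continuousOn
  contDiffOn := h.contDiffOn.sub h'.contDiffOn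
  growth T hT := by
    obtain ⟨C, l, hC, hl, hb⟩ := h.growth T hT
    obtain ⟨C', l', hC', hl', hb'⟩ := h'.growth T hT
    refine ⟨C + C', max l l', by positivity, by positivity, fun t ht x => ?_⟩
    have h1 : C * Real.exp (l * ‖x‖) ≤ C * Real.exp (max l l' * ‖x‖) := by
      gcongr; exact le_max_left _ _
    have h2 : C' * Real.exp (l' * ‖x‖) ≤ C' * Real.exp (max l l' * ‖x‖) := by
      gcongr; exact le_max_right _ _
    linarith [abs_sub (w t x) (w' t x), hb t ht x, hb' t ht x]

theorem mul_time (h : IsSpaceTimeRegular w) {a : ℝ → ℝ} (ha : ContinuousOn a (Ici 0))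
    (ha' : ContDiffOn ℝ (⊤ : ℕ∞) a (Ioi 0)) : IsSpaceTimeRegular (fun t x => a t * w t x) where
  continuousOn := (ha.comp continuousOn_fst fun q hq => hq.1).mul h.continuousOn
  contDiffOn := (ha'.comp contDiffOn_fst fun q hq => hq.1).mul h.contDiffOn
  growth T hT := by
    obtain ⟨C, l, hC, hl, hb⟩ := h.growth T hT
    obtain ⟨K, hK⟩ := isCompact_Icc.exists_bound_of_continuousOn
      (ha.mono (Icc_subset_Ici_self : Icc 0 T ⊆ Ici 0))
    have hK0 : 0 ≤ K := (norm_nonneg _).trans (hK 0 ⟨le_rfl, hT.le⟩)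
    refine ⟨K * C, l, by positivity, hl, fun t ht x => ?_⟩
    rw [abs_mul, mul_assoc]
    exact mul_le_mul (hK t ht) (hb t ht x) (abs_nonneg _) hK0

theorem neg (h : IsSpaceTimeRegular w) : IsSpaceTimeRegular (fun t x => -w t x) := by
  simpa using h.mul_time (a := fun _ => -1) (by fun_prop) (by fun_prop)

theorem laplacian_sub (h : IsSpaceTimeRegular w) (h' : IsSpaceTimeRegular w') {t : ℝ} (ht : 0 < t)
    (x : Plane) : (Δ fun y => w t y - w' t y) x = (Δ (w t)) x - (Δ (w' t)) x :=
  (h.contDiffAt_space ht x).laplacian_sub (h'.contDiffAt_space ht x)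

theorem laplacian_const_mul (h : IsSpaceTimeRegular w) (c : ℝ) {t : ℝ} (ht : 0 < t) (x : Plane) :
    (Δ fun y => c * w t y) x = c * (Δ (w t)) x :=
  InnerProductSpace.laplacian_smul c (h.contDiffAt_space ht x)

theorem laplacian_neg (w : ℝ → Plane → ℝ) (t : ℝ) (x : Plane) :
    (Δ fun y => -w t y) x = -(Δ (w t)) x :=
  congrFun (InnerProductSpace.laplacian_neg (f := w t)) x

end IsSpaceTimeRegular

/-- Since `‖y‖ ≤ ‖x‖ + ‖x - y‖`, the growth of `f` costs a constant depending on `x` and a larger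
linear exponent. This is the dominating function behind all later differentiations. -/
theorem ExpBounded.integrable_gaussian_mul {f : Plane → ℝ} (hf : ExpBounded f)
    (hfc : Continuous f) {a : ℝ} (ha : 0 < a) (k : ℝ) (x : Plane) :
    Integrable (fun y => Real.exp (-a * ‖x - y‖ ^ 2 + k * ‖x - y‖) * |f y|) := by
  obtain ⟨C, l, hC, hl, hb⟩ := hf
  have h1 := ((integrable_exp_neg_mul_norm_sq_add ha (k + l)).comp_sub_left x).const_mul
    (C * Real.exp (l * ‖x‖))
  refine h1.mono' (by fun_prop) (ae_of_all _ fun y => ?_)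
  rw [norm_mul, Real.norm_eq_abs, Real.abs_exp, Real.norm_eq_abs, abs_abs]
  have h2 : ‖y‖ ≤ ‖x‖ + ‖x - y‖ := by
    have := norm_sub_norm_le y x
    rw [norm_sub_rev] at this
    linarith
  calc Real.exp (-a * ‖x - y‖ ^ 2 + k * ‖x - y‖) * |f y|
      ≤ Real.exp (-a * ‖x - y‖ ^ 2 + k * ‖x - y‖) * (C * Real.exp (l * (‖x‖ + ‖x - y‖))) := by
        gcongr
        exact (hb y).trans (by gcongr)
    _ = C * Real.exp (l * ‖x‖) * Real.exp (-a * ‖x - y‖ ^ 2 + (k + l) * ‖x - y‖) := by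
        rw [mul_left_comm, mul_assoc, ← Real.exp_add, ← Real.exp_add]
        ring_nf

theorem heatSemigroup_zero (m : ℝ) (f : Plane → ℝ) (x : Plane) : heatSemigroup m 0 f x = f x := by
  simp [heatSemigroup]

theorem heatSemigroup_eq_exp_mul (m t : ℝ) (f : Plane → ℝ) (x : Plane) :
    heatSemigroup m t f x = Real.exp (m * t) * heatSemigroup 0 t f x := by
  by_cases ht : t = 0 <;> simp [heatSemigroup, ht]

theorem heatSemigroup_of_pos {t : ℝ} (ht : 0 < t) (f : Plane → ℝ) (x : Plane) :
    heatSemigroup 0 t f x = ∫ y, heatKernel t (x - y) * f y := by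
  simp [heatSemigroup, ht.ne']

/-- Substituting `y = x - √t • z` removes the singularity at `t = 0`. Continuity up to time zero and
growth bounds uniform on `[0, T]` follow from this form. -/
theorem heatSemigroup_eq_integral_scaled {t : ℝ} (ht : 0 ≤ t) (f : Plane → ℝ) (x : Plane) :
    heatSemigroup 0 t f x = ∫ z, heatKernel 1 z * f (x - √t • z) := by
  rcases ht.eq_or_lt with rfl | ht
  · simp [heatSemigroup_zero, integral_mul_const, integral_heatKernel]
  · rw [heatSemigroup_of_pos ht]
    have h1 : ∫ y, heatKernel t (x - y) * f y = ∫ u, heatKernel t u * f (x - u) := by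
      rw [← integral_sub_left_eq_self _ _ x]
      simp
    have h2 := Measure.integral_comp_smul (volume : Measure Plane)
      (fun u => heatKernel t u * f (x - u)) (√t)
    have h3 : ∀ z : Plane, heatKernel t (√t • z) = t⁻¹ * heatKernel 1 z := fun z => by
      rw [heatKernel, heatKernel, norm_smul, mul_pow, Real.norm_eq_abs, sq_abs, Real.sq_sqrt ht.le]
      field_simp
    simp only [h3, mul_assoc] at h2
    rw [integral_const_mul] at h2
    rw [h1]
    simp only [finrank_euclideanSpace, Fintype.card_fin, Real.sq_sqrt ht.le, smul_eq_mul,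
      abs_inv, abs_of_pos ht] at h2
    exact (mul_left_cancel₀ (inv_ne_zero ht.ne') h2).symm

theorem integrable_heatKernel_mul_exp (l : ℝ) :
    Integrable (fun z : Plane => heatKernel 1 z * Real.exp (l * ‖z‖)) := by
  refine ((integrable_exp_neg_mul_norm_sq_add (a := 1 / 2) (by norm_num) l).const_mul
    (1 / (2 * π))).congr (ae_of_all _ fun z => ?_)
  simp only [heatKernel_eq]
  rw [mul_assoc, ← Real.exp_add]
  norm_num

theorem continuousOn_heatSemigroup {f : Plane → ℝ} (hf : ExpBounded f) (hfc : Continuous f) :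
    ContinuousOn (fun q : ℝ × Plane => heatSemigroup 0 q.1 f q.2) (Ici 0 ×ˢ univ) := by
  -- The scaled integral is continuous on all of `ℝ × Plane`, because `√` vanishes on negative
  -- times.
  suffices h : Continuous fun q : ℝ × Plane => ∫ z, heatKernel 1 z * f (q.2 - √q.1 • z) from
    h.continuousOn.congr fun q hq => heatSemigroup_eq_integral_scaled hq.1 f q.2
  obtain ⟨C, l, hC, hl, hb⟩ := hf
  refine continuous_iff_continuousAt.mpr fun q₀ => ?_
  have hev : ∀ᶠ q : ℝ × Plane in 𝓝 q₀, ‖q.2‖ ≤ ‖q₀.2‖ + 1 ∧ √q.1 ≤ √q₀.1 + 1 := by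
    have c1 : Continuous fun q : ℝ × Plane => ‖q.2‖ := by fun_prop
    have c2 : Continuous fun q : ℝ × Plane => √q.1 := by fun_prop
    filter_upwards [c1.continuousAt.eventually (ge_mem_nhds (lt_add_one _)),
      c2.continuousAt.eventually (ge_mem_nhds (lt_add_one _))] with q h1 h2 using ⟨h1, h2⟩
  refine continuousAt_of_dominated
    (bound := fun z => C * Real.exp (l * (‖q₀.2‖ + 1)) *
      (heatKernel 1 z * Real.exp (l * (√q₀.1 + 1) * ‖z‖)))
    (Eventually.of_forall fun q => by fun_prop) ?_
    ((integrable_heatKernel_mul_exp _).const_mul _) (ae_of_all _ fun z => by fun_prop)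
  filter_upwards [hev] with q hq
  refine ae_of_all _ fun z => ?_
  rw [norm_mul, Real.norm_eq_abs, abs_of_pos (heatKernel_pos one_pos z), Real.norm_eq_abs]
  have h1 : ‖q.2 - √q.1 • z‖ ≤ (‖q₀.2‖ + 1) + (√q₀.1 + 1) * ‖z‖ := by
    refine (norm_sub_le _ _).trans ?_
    rw [norm_smul, Real.norm_eq_abs, abs_of_nonneg (Real.sqrt_nonneg _)]
    gcongr
    exacts [hq.1, hq.2]
  have := heatKernel_pos one_pos z
  calc heatKernel 1 z * |f (q.2 - √q.1 • z)|
      ≤ heatKernel 1 z * (C * Real.exp (l * ((‖q₀.2‖ + 1) + (√q₀.1 + 1) * ‖z‖))) := by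
        gcongr
        exact (hb _).trans (by gcongr)
    _ = _ := by
        rw [mul_add, Real.exp_add]
        ring_nf

theorem heatSemigroup_growth {f : Plane → ℝ} (hf : ExpBounded f) (T : ℝ) :
    ∃ C l : ℝ, 0 ≤ C ∧ 0 ≤ l ∧
      ∀ t ∈ Icc 0 T, ∀ x, |heatSemigroup 0 t f x| ≤ C * Real.exp (l * ‖x‖) := by
  obtain ⟨C, l, hC, hl, hb⟩ := hf
  refine ⟨C * ∫ z : Plane, heatKernel 1 z * Real.exp (l * √T * ‖z‖), l,
    mul_nonneg hC (integral_nonneg fun z => mul_nonneg (heatKernel_pos one_pos z).le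
      (Real.exp_pos _).le), hl, fun t ht x => ?_⟩
  rw [heatSemigroup_eq_integral_scaled ht.1, ← integral_const_mul, ← integral_mul_const,
    ← Real.norm_eq_abs]
  refine norm_integral_le_of_norm_le
    (((integrable_heatKernel_mul_exp _).const_mul _).mul_const _) (ae_of_all _ fun z => ?_)
  rw [norm_mul, Real.norm_eq_abs, abs_of_pos (heatKernel_pos one_pos z), Real.norm_eq_abs]
  have h1 : ‖x - √t • z‖ ≤ ‖x‖ + √T * ‖z‖ := by
    refine (norm_sub_le _ _).trans ?_
    rw [norm_smul, Real.norm_eq_abs, abs_of_nonneg (Real.sqrt_nonneg _)]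
    gcongr
    exact ht.2
  have := heatKernel_pos one_pos z
  calc heatKernel 1 z * |f (x - √t • z)|
      ≤ heatKernel 1 z * (C * Real.exp (l * (‖x‖ + √T * ‖z‖))) := by
        gcongr
        exact (hb _).trans (by gcongr)
    _ = _ := by
        rw [mul_add, Real.exp_add]
        ring_nf

/-- Expanding `‖x - y‖²` turns the exponent into `-‖x‖²/(2t)` plus an expression linear in the
parameters `(1/(2t), x/t)`. The semigroup is thus a smooth prefactor times a smooth exponential
integral composed with a smooth change of parameters. -/
theorem contDiffOn_heatSemigroup {f : Plane → ℝ} (hf : ExpBounded f) (hfc : Continuous f) :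
    ContDiffOn ℝ (⊤ : ℕ∞) (fun q : ℝ × Plane => heatSemigroup 0 q.1 f q.2) (Ioi 0 ×ˢ univ) := by
  set ℓ : Plane → ℝ × Plane →L[ℝ] ℝ := fun y =>
    (-‖y‖ ^ 2) • ContinuousLinearMap.fst ℝ ℝ Plane +
      (innerSL ℝ y).comp (ContinuousLinearMap.snd ℝ ℝ Plane) with hℓdef
  have hℓ : Continuous ℓ := by
    have h1 : Continuous fun y : Plane => innerSL ℝ y := (innerSL ℝ).continuous
    fun_prop
  have hnorm : ∀ y, ‖ℓ y‖ ≤ ‖y‖ ^ 2 + ‖y‖ := fun y => by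
    refine (norm_add_le _ _).trans (add_le_add ?_ ?_)
    · rw [norm_smul, norm_neg, norm_pow, norm_norm]
      exact mul_le_of_le_one_right (by positivity) (ContinuousLinearMap.norm_fst_le ..)
    · refine (ContinuousLinearMap.opNorm_comp_le _ _).trans ?_
      rw [innerSL_apply_norm]
      exact mul_le_of_le_one_right (by positivity) (ContinuousLinearMap.norm_snd_le ..)
  have hval : ∀ y q, ℓ y q = -‖y‖ ^ 2 * q.1 + inner ℝ y q.2 := fun y q => by simp [hℓdef]
  have hG : ContDiffOn ℝ (⊤ : ℕ∞) (fun q : ℝ × Plane => ∫ y, Real.exp (ℓ y q) • f y)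
      (Ioi 0 ×ˢ univ) := by
    refine contDiffOn_infty.mpr fun n => contDiffOn_integral_exp_smul
      hℓ.aestronglyMeasurable (isOpen_Ioi.prod isOpen_univ) n hfc.aestronglyMeasurable
      fun q hq => ⟨q.1 / 2, half_pos hq.1, ?_⟩
    have hq1 : (0 : ℝ) < q.1 := hq.1
    -- With margin `q.1 / 2` the exponent is at most `-(q.1/2)‖y‖² + (‖q.2‖ + q.1/2)‖y‖`, so half of
    -- the Gaussian decay survives.
    refine (hf.integrable_gaussian_mul hfc (half_pos hq1) (‖q.2‖ + q.1 / 2) 0).mono'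
      (by fun_prop) (ae_of_all _ fun y => ?_)
    rw [norm_mul, Real.norm_eq_abs, Real.abs_exp, norm_norm, Real.norm_eq_abs, zero_sub, norm_neg,
      hval]
    refine mul_le_mul_of_nonneg_right (Real.exp_le_exp.mpr ?_) (abs_nonneg _)
    have h1 := real_inner_le_norm y q.2
    have h2 := mul_le_mul_of_nonneg_left (hnorm y) (half_pos hq1).le
    nlinarith
  have hfst : ContDiffOn ℝ (⊤ : ℕ∞) (fun q : ℝ × Plane => q.1) (Ioi 0 ×ˢ univ) := by fun_prop
  have hsnd : ContDiffOn ℝ (⊤ : ℕ∞) (fun q : ℝ × Plane => q.2) (Ioi 0 ×ˢ univ) := by fun_prop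
  have hinv : ContDiffOn ℝ (⊤ : ℕ∞) (fun q : ℝ × Plane => (q.1)⁻¹) (Ioi 0 ×ˢ univ) :=
    hfst.inv fun q hq => (show (0 : ℝ) < q.1 from hq.1).ne'
  have hmap : ContDiffOn ℝ (⊤ : ℕ∞) (fun q : ℝ × Plane => ((2 : ℝ)⁻¹ * q.1⁻¹, q.1⁻¹ • q.2))
      (Ioi 0 ×ˢ univ) := (contDiffOn_const.mul hinv).prodMk (hinv.smul hsnd)
  have hmain := ((contDiffOn_const (c := (2 * π)⁻¹)).mul hinv).mul
    (((((hsnd.norm_sq ℝ).mul hinv).mul (contDiffOn_const (c := -(2 : ℝ)⁻¹)))).exp.mul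
      (hG.comp hmap fun q hq => ⟨by
        have : (0 : ℝ) < q.1 := hq.1
        simpa using this, mem_univ _⟩))
  refine hmain.congr fun q hq => ?_
  have hq1 : (0 : ℝ) < q.1 := hq.1
  rw [heatSemigroup_of_pos hq1]
  simp only [Function.comp, smul_eq_mul]
  rw [← integral_const_mul, ← integral_const_mul]
  congr 1
  ext y
  rw [hval, heatKernel, norm_sub_sq_real, ← mul_assoc, ← mul_assoc, mul_assoc _ (Real.exp _)
    (Real.exp _), ← Real.exp_add, inner_smul_right, real_inner_comm]
  congr 2
  · field_simp
  · congr 1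
    field_simp
    ring

theorem isSpaceTimeRegular_heatSemigroup {f : Plane → ℝ} (hf : ExpBounded f)
    (hfc : Continuous f) : IsSpaceTimeRegular (fun t x => heatSemigroup 0 t f x) :=
  ⟨continuousOn_heatSemigroup hf hfc, contDiffOn_heatSemigroup hf hfc,
    fun T _ => heatSemigroup_growth hf T⟩

/-! ### The heat equation -/

theorem heatSemigroup_eq_integral_exp {t : ℝ} (ht : 0 < t) (f : Plane → ℝ) (x : Plane) :
    heatSemigroup 0 t f x =
      1 / (2 * π * t) * ∫ y, Real.exp (1 / (2 * t) * -‖x - y‖ ^ 2) * f y := by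
  rw [heatSemigroup_of_pos ht, ← integral_const_mul]
  simp only [heatKernel_eq]
  congr 1
  ext y
  ring_nf

/-- In the variable `a = 1/(2t)` the exponent `-a‖x - y‖²` is linear; the chain rule and the
prefactor `1/(2πt)` give the two terms. -/
theorem hasDerivAt_heatSemigroup_time {f : Plane → ℝ} (hf : ExpBounded f) (hfc : Continuous f)
    {t : ℝ} (ht : 0 < t) (x : Plane) :
    HasDerivAt (fun s => heatSemigroup 0 s f x)
      (1 / (2 * π * t) * ((∫ y, Real.exp (1 / (2 * t) * -‖x - y‖ ^ 2) * (‖x - y‖ ^ 2 * f y))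
        / (2 * t ^ 2) - (∫ y, Real.exp (1 / (2 * t) * -‖x - y‖ ^ 2) * f y) / t)) t := by
  have h1 : HasDerivAt (fun a : ℝ => ∫ y, Real.exp (a * -‖x - y‖ ^ 2) * f y)
      (∫ y, Real.exp (1 / (2 * t) * -‖x - y‖ ^ 2) * (-‖x - y‖ ^ 2 * f y)) (1 / (2 * t)) := by
    refine hasDerivAt_integral_exp_mul (r := 1 / (4 * t)) (by fun_prop) (by fun_prop)
      (by positivity) ?_
    refine (hf.integrable_gaussian_mul hfc (a := 1 / (4 * t)) (by positivity) 0 x).congr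
      (ae_of_all _ fun y => ?_)
    simp only [abs_neg, abs_pow, abs_norm]
    congr 2
    field_simp
    ring
  have h2 : HasDerivAt (fun s : ℝ => 1 / (2 * s)) (-1 / (2 * t ^ 2)) t := by
    have := (hasDerivAt_inv ht.ne').const_mul (2 : ℝ)⁻¹
    refine (this.congr_of_eventuallyEq (Eventually.of_forall fun s => ?_)).congr_deriv ?_
    · simp only [one_div, mul_inv]
    · ring
  have h3 : HasDerivAt (fun s : ℝ => 1 / (2 * π * s)) (-1 / (2 * π * t ^ 2)) t := by
    have := (hasDerivAt_inv ht.ne').const_mul (2 * π)⁻¹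
    refine (this.congr_of_eventuallyEq (Eventually.of_forall fun s => ?_)).congr_deriv ?_
    · simp only [one_div, mul_inv]
    · ring
  have h4 := h3.mul (h1.comp t h2)
  refine (h4.congr_of_eventuallyEq ?_).congr_deriv ?_
  · filter_upwards [lt_mem_nhds ht] with s hs using heatSemigroup_eq_integral_exp hs f x
  · simp only [Function.comp, neg_mul, mul_neg, integral_neg]
    field_simp
    ring

/-- Along `x + s • e`, the identity `‖x + s e - y‖² = ‖x - y‖² + 2 s (x - y)_i + s²` factors the
integral into `exp(-s²/(2t))` times an exponential integral linear in `s`, which can be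
differentiated twice. -/
theorem deriv_deriv_heatSemigroup {f : Plane → ℝ} (hf : ExpBounded f) (hfc : Continuous f)
    {t : ℝ} (ht : 0 < t) (x : Plane) (i : Fin 2) :
    deriv (deriv fun s : ℝ => heatSemigroup 0 t f (x + s • EuclideanSpace.single i (1 : ℝ))) 0 =
      1 / (2 * π * t) * ((∫ y, Real.exp (1 / (2 * t) * -‖x - y‖ ^ 2) * ((x - y) i ^ 2 * f y))
        / t ^ 2 - (∫ y, Real.exp (1 / (2 * t) * -‖x - y‖ ^ 2) * f y) / t) := by
  set e : Plane := EuclideanSpace.single i (1 : ℝ) with he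
  set c : Plane → ℝ := fun y => -(x - y) i / t with hc
  have hcc : Continuous c := by fun_prop
  have hcb : ∀ y, |c y| ≤ ‖x - y‖ / t := fun y => by
    rw [hc, abs_div, abs_neg, abs_of_pos ht]
    gcongr
    exact PiLp.norm_apply_le (x - y) i
  set g : Plane → ℝ := fun y => Real.exp (1 / (2 * t) * -‖x - y‖ ^ 2) * f y with hg
  have hgc : Continuous g := by fun_prop
  have hbase : ∀ k : ℝ, 0 ≤ k → Integrable fun y => Real.exp (k * |c y|) * |g y| := fun k hk => by
    refine (hf.integrable_gaussian_mul hfc (a := 1 / (2 * t)) (by positivity) (k / t) x).mono'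
      (by fun_prop) (ae_of_all _ fun y => ?_)
    rw [norm_mul, Real.norm_eq_abs, Real.abs_exp, Real.norm_eq_abs, abs_abs, hg, abs_mul,
      Real.abs_exp, ← mul_assoc, ← Real.exp_add]
    refine mul_le_mul_of_nonneg_right (Real.exp_le_exp.mpr ?_) (abs_nonneg _)
    have := mul_le_mul_of_nonneg_left (hcb y) hk
    have h2 : k * (‖x - y‖ / t) = k / t * ‖x - y‖ := by ring
    linarith
  have hi0 : ∀ s : ℝ, Integrable fun y => Real.exp (s * c y + 1 * |c y|) * |g y| := fun s => by
    refine (hbase (|s| + 1) (by positivity)).mono' (by fun_prop) (ae_of_all _ fun y => ?_)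
    rw [norm_mul, Real.norm_eq_abs, Real.abs_exp, Real.norm_eq_abs, abs_abs, add_mul, ← abs_mul]
    gcongr
    exact le_abs_self _
  have hi1 : Integrable fun y => Real.exp ((0 : ℝ) * c y + 1 * |c y|) * |c y * g y| := by
    refine (hbase 2 (by positivity)).mono' (by fun_prop) (ae_of_all _ fun y => ?_)
    rw [norm_mul, Real.norm_eq_abs, Real.abs_exp, Real.norm_eq_abs, abs_abs, abs_mul, ← mul_assoc]
    refine mul_le_mul_of_nonneg_right ?_ (abs_nonneg _)
    have h2 : |c y| ≤ Real.exp |c y| := by linarith [Real.add_one_le_exp |c y|]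
    calc _ ≤ Real.exp (0 * c y + 1 * |c y|) * Real.exp |c y| := by gcongr
      _ = _ := by rw [← Real.exp_add]; ring_nf
  have hN := fun s => hasDerivAt_integral_exp_mul (q₀ := s) (hcc.aestronglyMeasurable (μ := volume))
    hgc.aestronglyMeasurable one_pos (hi0 s)
  have hN' := hasDerivAt_integral_exp_mul (q₀ := 0) (hcc.aestronglyMeasurable (μ := volume))
    (g := fun y => c y * g y) (by fun_prop) one_pos hi1
  have hE : ∀ s : ℝ, HasDerivAt (fun s : ℝ => Real.exp (-s ^ 2 / (2 * t)))
      (Real.exp (-s ^ 2 / (2 * t)) * (-s / t)) s := fun s => by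
    have h1 : HasDerivAt (fun s : ℝ => -s ^ 2 / (2 * t)) (-s / t) s := by
      refine ((hasDerivAt_pow 2 s).neg.div_const (2 * t)).congr_deriv ?_
      field_simp
      norm_num
    exact h1.exp
  have hform : (fun s : ℝ => heatSemigroup 0 t f (x + s • e)) = fun s =>
      1 / (2 * π * t) * (Real.exp (-s ^ 2 / (2 * t)) * ∫ y, Real.exp (s * c y) * g y) := by
    ext s
    rw [heatSemigroup_eq_integral_exp ht, ← integral_const_mul (Real.exp _)]
    congr 2
    ext y
    rw [hg, ← mul_assoc, ← mul_assoc, ← Real.exp_add, ← Real.exp_add]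
    congr 2
    have h1 : x + s • e - y = (x - y) + s • e := by abel
    rw [h1, norm_add_sq_real, inner_smul_right, norm_smul, mul_pow, he, PiLp.norm_single,
      EuclideanSpace.inner_single_right]
    simp [hc]
    field_simp
    ring
  have hd1 : (deriv fun s : ℝ => heatSemigroup 0 t f (x + s • e)) = fun s =>
      1 / (2 * π * t) * (Real.exp (-s ^ 2 / (2 * t)) * (-s / t) * (∫ y, Real.exp (s * c y) * g y) +
        Real.exp (-s ^ 2 / (2 * t)) * ∫ y, Real.exp (s * c y) * (c y * g y)) := by
    rw [hform]
    ext s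
    exact (((hE s).mul (hN s)).const_mul _).deriv
  rw [hd1]
  have hs : HasDerivAt (fun s : ℝ => -s / t) (-1 / t) 0 := (hasDerivAt_id _).neg.div_const t
  have hfin := (((((hE 0).mul hs).mul (hN 0)).add ((hE 0).mul hN')).const_mul
    (1 / (2 * π * t))).deriv
  refine hfin.trans ?_
  have hM2 : (∫ y, Real.exp (0 * c y) * (c y * (c y * g y))) =
      (∫ y, Real.exp (1 / (2 * t) * -‖x - y‖ ^ 2) * ((x - y) i ^ 2 * f y)) / t ^ 2 := by
    rw [← integral_div]
    congr 1
    ext y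
    simp only [hc, hg, zero_mul, Real.exp_zero]
    field_simp
  have hM0 : (∫ y, Real.exp (0 * c y) * g y) =
      ∫ y, Real.exp (1 / (2 * t) * -‖x - y‖ ^ 2) * f y := by
    simp only [hg, zero_mul, Real.exp_zero, one_mul]
  rw [hM2, hM0]
  generalize (∫ y, Real.exp (1 / (2 * t) * -‖x - y‖ ^ 2) * f y) = A
  generalize (∫ y, Real.exp (1 / (2 * t) * -‖x - y‖ ^ 2) * ((x - y) i ^ 2 * f y)) = B
  simp only [Pi.mul_apply, ne_eq, OfNat.ofNat_ne_zero, not_false_eq_true, zero_pow, neg_zero,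
    zero_div, Real.exp_zero]
  ring

/-- The two coordinate second moments add up to that of `‖x - y‖²`, and the two terms `-1/t`, one
per dimension, match the derivative of the prefactor `1/(2πt)`. -/
theorem deriv_heatSemigroup {f : Plane → ℝ} (hf : ExpBounded f) (hfc : Continuous f)
    {t : ℝ} (ht : 0 < t) (x : Plane) :
    deriv (fun s => heatSemigroup 0 s f x) t = 1 / 2 * (Δ (heatSemigroup 0 t f)) x := by
  rw [laplacian_eq_sum_deriv_deriv
      ((isSpaceTimeRegular_heatSemigroup hf hfc).contDiffAt_space ht x),
    (hasDerivAt_heatSemigroup_time hf hfc ht x).deriv, Fin.sum_univ_two,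
    deriv_deriv_heatSemigroup hf hfc ht, deriv_deriv_heatSemigroup hf hfc ht]
  have hint : ∀ i : Fin 2, Integrable fun y =>
      Real.exp (1 / (2 * t) * -‖x - y‖ ^ 2) * ((x - y) i ^ 2 * f y) := fun i => by
    refine ((hf.integrable_gaussian_mul hfc (a := 1 / (2 * t)) (by positivity) 1 x).const_mul
      2).mono' (by fun_prop) (ae_of_all _ fun y => ?_)
    rw [norm_mul, Real.norm_eq_abs, Real.abs_exp, norm_mul, norm_pow, Real.exp_add]
    have h1 : ‖(x - y) i‖ ^ 2 ≤ ‖x - y‖ ^ 2 := by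
      gcongr
      exact PiLp.norm_apply_le (x - y) i
    have h2 : ‖x - y‖ ^ 2 ≤ 2 * Real.exp (1 * ‖x - y‖) := by
      have := Real.pow_div_factorial_le_exp ‖x - y‖ (norm_nonneg _) 2
      rw [one_mul]
      norm_num at this
      linarith
    have h3 : Real.exp (1 / (2 * t) * -‖x - y‖ ^ 2) = Real.exp (-(1 / (2 * t)) * ‖x - y‖ ^ 2) := by
      ring_nf
    rw [h3, Real.norm_eq_abs (f y)]
    calc Real.exp (-(1 / (2 * t)) * ‖x - y‖ ^ 2) * (‖(x - y) i‖ ^ 2 * |f y|)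
        ≤ Real.exp (-(1 / (2 * t)) * ‖x - y‖ ^ 2) * (2 * Real.exp (1 * ‖x - y‖) * |f y|) := by
          gcongr
          exact h1.trans h2
      _ = _ := by ring
  have hsum : (∫ y, Real.exp (1 / (2 * t) * -‖x - y‖ ^ 2) * (‖x - y‖ ^ 2 * f y)) =
      (∫ y, Real.exp (1 / (2 * t) * -‖x - y‖ ^ 2) * ((x - y) 0 ^ 2 * f y)) +
      ∫ y, Real.exp (1 / (2 * t) * -‖x - y‖ ^ 2) * ((x - y) 1 ^ 2 * f y) := by
    rw [← integral_add (hint 0) (hint 1)]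
    congr 1
    ext y
    rw [EuclideanSpace.norm_sq_eq (x - y), Fin.sum_univ_two]
    simp only [Real.norm_eq_abs, sq_abs]
    ring
  rw [hsum]
  field_simp
  ring

/-! ### The maximum principle -/

/-- A positive second derivative would make the point a local minimum as well, so the function would
be locally constant and its second derivative zero. -/
theorem deriv_deriv_nonpos_of_isLocalMax {f : ℝ → ℝ} {x : ℝ} (h : IsLocalMax f x)
    (hc : ContinuousAt f x) : deriv (deriv f) x ≤ 0 := by
  by_contra! hpos
  have hmin := isLocalMin_of_deriv_deriv_pos hpos h.deriv_eq_zero hc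
  have hconst : f =ᶠ[𝓝 x] fun _ => f x := by
    filter_upwards [h, hmin] with y h1 h2 using le_antisymm h1 h2
  have h1 : deriv f =ᶠ[𝓝 x] fun _ => 0 := by
    simpa using hconst.deriv
  rw [h1.deriv_eq] at hpos
  simp at hpos

theorem laplacian_nonpos_of_isLocalMax {φ : Plane → ℝ} {x : Plane} (h : IsLocalMax φ x)
    (hφ : ContDiffAt ℝ 2 φ x) : (Δ φ) x ≤ 0 := by
  rw [laplacian_eq_sum_deriv_deriv hφ]
  refine Finset.sum_nonpos fun i _ => deriv_deriv_nonpos_of_isLocalMax ?_ ?_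
  · have hc : ContinuousAt (fun s : ℝ => x + s • EuclideanSpace.single i (1 : ℝ)) 0 := by fun_prop
    have h' : IsLocalMax φ (x + (0 : ℝ) • EuclideanSpace.single i (1 : ℝ)) := by simpa using h
    exact hc.tendsto.eventually h'
  · have hc : ContinuousAt (fun s : ℝ => x + s • EuclideanSpace.single i (1 : ℝ)) 0 := by fun_prop
    exact ContinuousAt.comp_of_eq hφ.continuousAt hc (by simp)

theorem HasDerivAt.nonneg_of_le_left {f : ℝ → ℝ} {f' a b : ℝ} (h : HasDerivAt f f' b) (hab : a < b)
    (hle : ∀ s ∈ Ioo a b, f s ≤ f b) : 0 ≤ f' := by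
  have h1 : Tendsto (slope f b) (𝓝[<] b) (𝓝 f') :=
    h.tendsto_slope.mono_left (nhdsWithin_mono _ fun s (hs : s < b) => hs.ne)
  refine ge_of_tendsto h1 ?_
  filter_upwards [Ioo_mem_nhdsLT hab] with s hs
  rw [slope_def_field]
  exact div_nonneg_of_nonpos (by linarith [hle s hs]) (by linarith [hs.2])

/-- The spatial profile of the barrier in the maximum principle. -/
def coshBarrier (a : ℝ) (x : Plane) : ℝ := Real.cosh (a * x 0) * Real.cosh (a * x 1)

theorem coshBarrier_pos (a : ℝ) (x : Plane) : 0 < coshBarrier a x :=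
  mul_pos (Real.cosh_pos _) (Real.cosh_pos _)

theorem contDiff_coshBarrier (a : ℝ) : ContDiff ℝ 2 (coshBarrier a) := by
  unfold coshBarrier
  have h : ∀ i : Fin 2, ContDiff ℝ 2 fun x : Plane => x i := fun i => by fun_prop
  exact (contDiff_const.mul (h 0)).cosh.mul (contDiff_const.mul (h 1)).cosh

theorem laplacian_coshBarrier (a : ℝ) (x : Plane) :
    (Δ (coshBarrier a)) x = 2 * a ^ 2 * coshBarrier a x := by
  have key : ∀ u : ℝ, deriv (deriv fun s : ℝ => Real.cosh (a * (u + s))) 0 =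
      a ^ 2 * Real.cosh (a * u) := fun u => by
    have h0 : ∀ s : ℝ, HasDerivAt (fun s : ℝ => a * (u + s)) a s := fun s => by
      simpa using ((hasDerivAt_id s).const_add u).const_mul a
    have h1 : (deriv fun s : ℝ => Real.cosh (a * (u + s))) =
        fun s => Real.sinh (a * (u + s)) * a := funext fun s => (h0 s).cosh.deriv
    rw [h1, (((h0 0).sinh).mul_const a).deriv, add_zero]
    ring
  rw [laplacian_eq_sum_deriv_deriv (contDiff_coshBarrier a).contDiffAt, Fin.sum_univ_two]
  simp only [coshBarrier, PiLp.add_apply, PiLp.smul_apply, smul_eq_mul]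
  simp only [PiLp.single_apply, Fin.isValue, ↓reduceIte, mul_one, mul_zero, add_zero, one_ne_zero,
    zero_ne_one]
  simp only [deriv_mul_const_field', deriv_const_mul_field', deriv_mul_const_field,
    deriv_const_mul_field, key]
  ring

/-- Lets the smooth product barrier dominate radial exponential growth. -/
theorem exp_le_coshBarrier {a : ℝ} (ha : 0 ≤ a) (x : Plane) :
    Real.exp (a * ‖x‖) ≤ 4 * coshBarrier a x := by
  have h1 : ∀ u : ℝ, Real.exp (a * |u|) ≤ 2 * Real.cosh (a * u) := fun u => by
    have h2 : Real.cosh (a * u) = Real.cosh (a * |u|) := by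
      rw [← Real.cosh_abs, abs_mul, abs_of_nonneg ha]
    rw [h2, Real.cosh_eq]
    linarith [Real.exp_pos (-(a * |u|))]
  have h3 : ‖x‖ ≤ |x 0| + |x 1| := by
    rw [EuclideanSpace.norm_eq, Fin.sum_univ_two]
    refine Real.sqrt_le_iff.mpr ⟨by positivity, ?_⟩
    simp only [Real.norm_eq_abs]
    nlinarith [mul_nonneg (abs_nonneg (x 0)) (abs_nonneg (x 1))]
  calc Real.exp (a * ‖x‖) ≤ Real.exp (a * (|x 0| + |x 1|)) := by gcongr
    _ = Real.exp (a * |x 0|) * Real.exp (a * |x 1|) := by rw [mul_add, Real.exp_add]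
    _ ≤ (2 * Real.cosh (a * x 0)) * (2 * Real.cosh (a * x 1)) :=
        mul_le_mul (h1 _) (h1 _) (Real.exp_pos _).le (by positivity)
    _ = _ := by rw [coshBarrier]; ring

/-- Subtract a small multiple of a strict supersolution growing faster than `w`. If `w` were
positive somewhere, the difference would have a positive maximum at a positive time and an interior
point of a large ball, contradicting the differential inequality. That inequality is needed only
where `w > 0`, which later gives the potential terms a sign. -/
theorem IsSpaceTimeRegular.nonpos_of_subsolution_zero {w : ℝ → Plane → ℝ}
    (h : IsSpaceTimeRegular w) (h0 : ∀ x, w 0 x ≤ 0) {t : ℝ} (ht : 0 ≤ t)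
    (hsub : ∀ s, 0 < s → s ≤ t → ∀ x, 0 < w s x →
      deriv (fun s => w s x) s ≤ 1 / 2 * (Δ (w s)) x) (x : Plane) :
    w t x ≤ 0 := by
  by_contra! hpos
  have ht0 : 0 < t := ht.lt_of_ne fun h1 => by
    subst h1
    exact absurd (h0 x) (not_le.mpr hpos)
  obtain ⟨C, l, hC, hl, hb⟩ := h.growth t ht0
  set a := l + 1 with ha
  -- Half the Laplacian of the barrier is `a²` times the barrier, so the growth rate `a² + 1` makes
  -- `B` a strict supersolution.
  set M := a ^ 2 + 1 with hM
  set B : ℝ → Plane → ℝ := fun s y => Real.exp (M * s) * coshBarrier a y with hB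
  have hBpos : ∀ s y, 0 < B s y := fun s y => mul_pos (Real.exp_pos _) (coshBarrier_pos a y)
  -- With this choice `w - δ B` equals `w t x / 2 > 0` at the given point.
  set δ := w t x / (2 * B t x) with hδ
  have hδ0 : 0 < δ := div_pos hpos (mul_pos two_pos (hBpos t x))
  -- Beyond `4C/δ` the extra exponential rate in `a = l + 1` forces `w < δ B`; the maximum with
  -- `‖x‖` keeps the given point in the ball.
  set R := max (4 * C / δ) ‖x‖ with hR
  have hcont : ContinuousOn (fun q : ℝ × Plane => w q.1 q.2 - δ * B q.1 q.2)
      (Icc 0 t ×ˢ Metric.closedBall 0 R) := by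
    have h1 := (contDiff_coshBarrier a).continuous
    have h2 : Continuous fun q : ℝ × Plane => δ * B q.1 q.2 := by
      simp only [hB]
      fun_prop
    exact (h.continuousOn.mono fun q hq => ⟨hq.1.1, mem_univ _⟩).sub h2.continuousOn
  have hxmem : (t, x) ∈ Icc (0 : ℝ) t ×ˢ Metric.closedBall (0 : Plane) R :=
    ⟨⟨ht, le_rfl⟩, by simp [hR]⟩
  obtain ⟨⟨t₁, x₁⟩, ⟨ht₁, hx₁⟩, hmax⟩ :=
    (isCompact_Icc.prod (isCompact_closedBall (0 : Plane) R)).exists_isMaxOn ⟨_, hxmem⟩ hcont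
  have hval : 0 < w t₁ x₁ - δ * B t₁ x₁ := by
    have h1 : w t x - δ * B t x ≤ w t₁ x₁ - δ * B t₁ x₁ := hmax hxmem
    have h2 : δ * B t x = w t x / 2 := by
      rw [hδ]
      have := (hBpos t x).ne'
      field_simp
    linarith
  have hw₁ : 0 < w t₁ x₁ := by linarith [mul_pos hδ0 (hBpos t₁ x₁)]
  have ht₁0 : 0 < t₁ := ht₁.1.lt_of_ne fun h1 => by
    simp only at h1
    rw [← h1] at hw₁
    exact absurd (h0 x₁) (not_le.mpr hw₁)
  have hx₁R : ‖x₁‖ < R := by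
    by_contra! hge
    have h1 : w t₁ x₁ ≤ C * Real.exp (l * ‖x₁‖) := (le_abs_self _).trans (hb t₁ ht₁ x₁)
    have h2 : coshBarrier a x₁ ≤ B t₁ x₁ :=
      le_mul_of_one_le_left (coshBarrier_pos a x₁).le
        (Real.one_le_exp (mul_nonneg (by positivity) ht₁0.le))
    have h3 := exp_le_coshBarrier (a := a) (by positivity) x₁
    have h4 : Real.exp (a * ‖x₁‖) = Real.exp (l * ‖x₁‖) * Real.exp ‖x₁‖ := by
      rw [← Real.exp_add, ha]
      ring_nf
    have h5 : 4 * C / δ < Real.exp ‖x₁‖ := by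
      have := Real.add_one_le_exp ‖x₁‖
      have h6 : 4 * C / δ ≤ R := le_max_left _ _
      linarith
    rw [div_lt_iff₀ hδ0] at h5
    have h6 := mul_lt_mul_of_pos_left h5 (Real.exp_pos (l * ‖x₁‖))
    have h7 : δ * Real.exp (a * ‖x₁‖) ≤ δ * (4 * B t₁ x₁) := by gcongr; linarith
    rw [h4] at h7
    nlinarith
  have hderiv : HasDerivAt (fun s => w s x₁ - δ * B s x₁)
      (deriv (fun s => w s x₁) t₁ - δ * (M * B t₁ x₁)) t₁ := by
    have h1 : HasDerivAt (fun s => B s x₁) (M * B t₁ x₁) t₁ := by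
      have := (((hasDerivAt_id t₁).const_mul M).exp).mul_const (coshBarrier a x₁)
      refine this.congr_deriv ?_
      simp only [hB, id]
      ring
    exact (h.differentiableAt_time ht₁0 x₁).hasDerivAt.sub (h1.const_mul δ)
  -- The maximum may sit at the final time `t`, so only the left difference quotient is controlled.
  have htime : 0 ≤ deriv (fun s => w s x₁) t₁ - δ * (M * B t₁ x₁) :=
    HasDerivAt.nonneg_of_le_left hderiv ht₁0 fun s hs =>
      hmax (show (s, x₁) ∈ _ from ⟨⟨hs.1.le, hs.2.le.trans ht₁.2⟩, hx₁⟩)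
  have hB2 : ContDiffAt ℝ 2 (fun y => δ * B t₁ y) x₁ :=
    contDiffAt_const.mul (contDiffAt_const.mul (contDiff_coshBarrier a).contDiffAt)
  have hlapB : (Δ fun y => δ * B t₁ y) x₁ = δ * (2 * a ^ 2 * B t₁ x₁) := by
    have h1 : (fun y => δ * B t₁ y) = (δ * Real.exp (M * t₁)) • coshBarrier a := by
      ext y
      simp only [hB, Pi.smul_apply, smul_eq_mul]
      ring
    rw [h1, InnerProductSpace.laplacian_smul _ (contDiff_coshBarrier a).contDiffAt,
      laplacian_coshBarrier, smul_eq_mul]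
    ring
  have hspace : (Δ fun y => w t₁ y - δ * B t₁ y) x₁ ≤ 0 := by
    refine laplacian_nonpos_of_isLocalMax ?_ ((h.contDiffAt_space ht₁0 x₁).sub hB2)
    have hnhds : Metric.closedBall (0 : Plane) R ∈ 𝓝 x₁ :=
      mem_of_superset (Metric.isOpen_ball.mem_nhds (by simpa using hx₁R)) Metric.ball_subset_closedBall
    filter_upwards [hnhds] with y hy using hmax (show (t₁, y) ∈ _ from ⟨ht₁, hy⟩)
  have hlap := (h.contDiffAt_space ht₁0 x₁).laplacian_sub hB2
  rw [hlapB] at hlap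
  have hlap' : (Δ (w t₁)) x₁ ≤ δ * (2 * a ^ 2 * B t₁ x₁) := by
    have : (Δ fun y => w t₁ y - δ * B t₁ y) x₁ = (Δ (w t₁ - fun y => δ * B t₁ y)) x₁ := rfl
    linarith
  have := hsub t₁ ht₁0 ht₁.2 x₁ hw₁
  have := mul_pos hδ0 (hBpos t₁ x₁)
  rw [hM] at htime
  nlinarith

/-- The factor `exp(-K s)` removes the zeroth-order term and preserves signs. -/
theorem IsSpaceTimeRegular.nonpos_of_subsolution {w : ℝ → Plane → ℝ} (h : IsSpaceTimeRegular w)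
    (K : ℝ) (h0 : ∀ x, w 0 x ≤ 0) {t : ℝ} (ht : 0 ≤ t)
    (hsub : ∀ s, 0 < s → s ≤ t → ∀ x, 0 < w s x →
      deriv (fun s => w s x) s ≤ 1 / 2 * (Δ (w s)) x + K * w s x) (x : Plane) :
    w t x ≤ 0 := by
  have hreg := h.mul_time (a := fun s => Real.exp (-K * s)) (by fun_prop) (by fun_prop)
  have hE := fun s => Real.exp_pos (-K * s)
  have hmain := hreg.nonpos_of_subsolution_zero
    (fun y => mul_nonpos_of_nonneg_of_nonpos (hE 0).le (h0 y)) ht (fun s hs hst y hy => ?_) x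
  · exact (mul_nonpos_iff_pos_imp_nonpos.mp hmain).1 (hE t)
  · have hy' : 0 < w s y := (mul_pos_iff_of_pos_left (hE s)).mp hy
    have h1 : HasDerivAt (fun s => Real.exp (-K * s)) (Real.exp (-K * s) * -K) s := by
      simpa using ((hasDerivAt_id s).const_mul (-K)).exp
    have h2 : HasDerivAt (fun s => Real.exp (-K * s) * w s y) _ s :=
      h1.mul (h.differentiableAt_time hs y).hasDerivAt
    rw [h2.deriv, h.laplacian_const_mul _ hs y]
    have := mul_le_mul_of_nonneg_left (hsub s hs hst y hy') (hE s).le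
    linarith

/-! ### Tempered distributions tested against translates -/

theorem exists_decay_bound (φ : 𝓢(Plane, ℝ)) (k n : ℕ) :
    ∃ A : ℝ, 0 ≤ A ∧ ∀ z, (1 + ‖z‖) ^ k * ‖iteratedFDeriv ℝ n φ z‖ ≤ A :=
  ⟨_, by positivity, fun z =>
    SchwartzMap.one_add_le_sup_seminorm_apply (𝕜 := ℝ) (m := (k, n)) le_rfl le_rfl φ z⟩

theorem iteratedFDeriv_compSubConst (φ : 𝓢(Plane, ℝ)) (x y : Plane) (n : ℕ) :
    iteratedFDeriv ℝ n (SchwartzMap.compSubConstCLM ℝ x φ) y = iteratedFDeriv ℝ n φ (y - x) :=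
  iteratedFDeriv_comp_sub (f := φ) n x y

theorem norm_pow_le_of_sub {R : ℝ} {y z : Plane} (h : ‖y - z‖ ≤ R) (k : ℕ) :
    ‖y‖ ^ k ≤ (1 + R) ^ k * (1 + ‖z‖) ^ k := by
  rw [← mul_pow]
  have h1 : ‖y‖ ≤ ‖y - z‖ + ‖z‖ := by simpa using norm_add_le (y - z) z
  have h2 := norm_nonneg z
  have h3 := (norm_nonneg _).trans h
  gcongr
  nlinarith [mul_nonneg h3 h2]

theorem seminorm_compSubConst_le (φ : 𝓢(Plane, ℝ)) (k n : ℕ) :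
    ∃ A : ℝ, 0 ≤ A ∧ ∀ x, SchwartzMap.seminorm ℝ k n (SchwartzMap.compSubConstCLM ℝ x φ) ≤
      A * Real.exp (k * ‖x‖) := by
  obtain ⟨A, hA, hb⟩ := exists_decay_bound φ k n
  refine ⟨A, hA, fun x => SchwartzMap.seminorm_le_bound ℝ k n _ (by positivity) fun y => ?_⟩
  rw [iteratedFDeriv_compSubConst]
  have h1 := norm_pow_le_of_sub (R := ‖x‖) (y := y) (z := y - x) (by simp) k
  have h2 : (1 + ‖x‖) ^ k ≤ Real.exp (k * ‖x‖) := by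
    rw [Real.exp_nat_mul]
    gcongr
    linarith [Real.add_one_le_exp ‖x‖]
  calc ‖y‖ ^ k * ‖iteratedFDeriv ℝ n φ (y - x)‖
      ≤ (1 + ‖x‖) ^ k * (1 + ‖y - x‖) ^ k * ‖iteratedFDeriv ℝ n φ (y - x)‖ := by gcongr
    _ = (1 + ‖x‖) ^ k * ((1 + ‖y - x‖) ^ k * ‖iteratedFDeriv ℝ n φ (y - x)‖) := by ring
    _ ≤ Real.exp (k * ‖x‖) * A := by
        gcongr
        exact hb _
    _ = _ := mul_comm _ _

/-- The mean value inequality along the segment between the two shifted arguments costs one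
derivative of `φ`; `‖x - x₀‖ ≤ 1` makes the polynomial weights uniform. -/
theorem seminorm_compSubConst_sub_le (φ : 𝓢(Plane, ℝ)) (k n : ℕ) (x₀ : Plane) :
    ∃ A : ℝ, ∀ x, ‖x - x₀‖ ≤ 1 →
      SchwartzMap.seminorm ℝ k n
        (SchwartzMap.compSubConstCLM ℝ x φ - SchwartzMap.compSubConstCLM ℝ x₀ φ) ≤
      A * ‖x - x₀‖ := by
  obtain ⟨A, hA, hb⟩ := exists_decay_bound φ k (n + 1)
  refine ⟨(1 + (‖x₀‖ + 1)) ^ k * A, fun x hx => SchwartzMap.seminorm_le_bound ℝ k n _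
    (by positivity) fun y => ?_⟩
  have hsub : iteratedFDeriv ℝ n
      (⇑(SchwartzMap.compSubConstCLM ℝ x φ - SchwartzMap.compSubConstCLM ℝ x₀ φ)) y =
      iteratedFDeriv ℝ n φ (y - x) - iteratedFDeriv ℝ n φ (y - x₀) := by
    have h1 : ∀ ψ : 𝓢(Plane, ℝ), ContDiffAt ℝ n ψ y := fun ψ => (ψ.smooth n).contDiffAt
    rw [← iteratedFDeriv_compSubConst, ← iteratedFDeriv_compSubConst]
    exact iteratedFDeriv_sub_apply (h1 _) (h1 _)
  rw [hsub]
  have hmv : ‖y‖ ^ k * ‖iteratedFDeriv ℝ n φ (y - x) - iteratedFDeriv ℝ n φ (y - x₀)‖ ≤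
    (1 + (‖x₀‖ + 1)) ^ k * A * ‖(y - x) - (y - x₀)‖ := by
    have hd : Differentiable ℝ (iteratedFDeriv ℝ n φ) :=
      (φ.smooth (n + 1)).differentiable_iteratedFDeriv (by exact_mod_cast Nat.lt_succ_self n)
    have := (convex_segment (y - x₀) (y - x)).norm_image_sub_le_of_norm_fderiv_le
      (f := fun z => ‖y‖ ^ k • iteratedFDeriv ℝ n φ z) (C := (1 + (‖x₀‖ + 1)) ^ k * A)
      (fun z _ => (hd z).const_smul (‖y‖ ^ k)) (fun z hz => ?_)
      (left_mem_segment ℝ _ _) (right_mem_segment ℝ _ _)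
    · rwa [← smul_sub, norm_smul, norm_pow, norm_norm] at this
    · rw [fderiv_fun_const_smul (hd z), norm_smul, norm_pow, norm_norm,
        norm_fderiv_iteratedFDeriv]
      have hz' : ‖y - z‖ ≤ ‖x₀‖ + 1 := by
        rw [segment_eq_image'] at hz
        obtain ⟨θ, hθ, rfl⟩ := hz
        have h2 : y - (y - x₀ + θ • (y - x - (y - x₀))) = x₀ + θ • (x - x₀) := by
          rw [show y - x - (y - x₀) = -(x - x₀) by abel, smul_neg]
          abel
        rw [h2]
        refine (norm_add_le _ _).trans ?_
        rw [norm_smul, Real.norm_eq_abs, abs_of_nonneg hθ.1]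
        have := mul_le_one₀ hθ.2 (norm_nonneg _) hx
        linarith
      calc ‖y‖ ^ k * ‖iteratedFDeriv ℝ (n + 1) φ z‖
          ≤ (1 + (‖x₀‖ + 1)) ^ k * (1 + ‖z‖) ^ k * ‖iteratedFDeriv ℝ (n + 1) φ z‖ := by
            gcongr
            exact norm_pow_le_of_sub hz' k
        _ = (1 + (‖x₀‖ + 1)) ^ k * ((1 + ‖z‖) ^ k * ‖iteratedFDeriv ℝ (n + 1) φ z‖) := by ring
        _ ≤ _ := by
            gcongr
            exact hb z
  rwa [sub_sub_sub_cancel_left, norm_sub_rev x₀ x] at hmv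

theorem exists_seminorm_bound (T : 𝓢(Plane, ℝ) →L[ℝ] ℝ) :
    ∃ (s : Finset (ℕ × ℕ)) (C : ℝ), 0 ≤ C ∧
      ∀ φ, |T φ| ≤ C * ∑ i ∈ s, SchwartzMap.seminorm ℝ i.1 i.2 φ := by
  obtain ⟨s, C, -, h⟩ := Seminorm.bound_of_continuous (schwartz_withSeminorms ℝ Plane ℝ)
    ((normSeminorm ℝ ℝ).comp T.toLinearMap) (by
      change Continuous fun φ => ‖T φ‖
      fun_prop)
  refine ⟨s, C, C.2, fun φ => ?_⟩
  have h1 : |T φ| ≤ C * (s.sup (schwartzSeminormFamily ℝ Plane ℝ)) φ := h φ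
  have h2 := Seminorm.finset_sup_le_sum (schwartzSeminormFamily ℝ Plane ℝ) s φ
  have h3 : (∑ i ∈ s, schwartzSeminormFamily ℝ Plane ℝ i) φ =
      ∑ i ∈ s, SchwartzMap.seminorm ℝ i.1 i.2 φ := by
    clear h h1 h2
    induction s using Finset.induction_on with
    | empty => rfl
    | insert i s hi ih =>
      rw [Finset.sum_insert hi, Finset.sum_insert hi, ← ih]
      rfl
  rw [h3] at h2
  exact h1.trans (mul_le_mul_of_nonneg_left h2 C.2)

theorem heatConv_eq (T : 𝓢(Plane, ℝ) →L[ℝ] ℝ) {s : ℝ} (hs : 0 < s) (x : Plane) :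
    heatConv T s x = T (SchwartzMap.compSubConstCLM ℝ x (heatTest s hs 0)) := by
  rw [heatConv, dif_pos hs]
  congr 1
  ext y
  change heatKernel s (x - y) = heatKernel s (0 - (y - x))
  simp

theorem continuous_heatConv (T : 𝓢(Plane, ℝ) →L[ℝ] ℝ) {s : ℝ} (hs : 0 < s) :
    Continuous (heatConv T s) := by
  obtain ⟨S, C, hC, hT⟩ := exists_seminorm_bound T
  set φ := heatTest s hs 0
  refine continuous_iff_continuousAt.mpr fun x₀ => ?_
  choose A hA using fun i : ℕ × ℕ => seminorm_compSubConst_sub_le φ i.1 i.2 x₀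
  have hlim : Tendsto (fun x => C * ∑ i ∈ S, A i * ‖x - x₀‖) (𝓝 x₀) (𝓝 0) := by
    have : Continuous fun x => C * ∑ i ∈ S, A i * ‖x - x₀‖ := by fun_prop
    simpa using this.tendsto x₀
  rw [ContinuousAt, tendsto_iff_norm_sub_tendsto_zero]
  refine squeeze_zero' (Eventually.of_forall fun x => norm_nonneg _) ?_ hlim
  filter_upwards [Metric.closedBall_mem_nhds x₀ one_pos] with x hx
  rw [heatConv_eq T hs, heatConv_eq T hs, ← map_sub, Real.norm_eq_abs]
  refine (hT _).trans (mul_le_mul_of_nonneg_left (Finset.sum_le_sum fun i _ => ?_) hC)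
  exact hA i x (by simpa [dist_eq_norm] using hx)

/-- A tempered distribution is controlled by finitely many Schwartz seminorms, and those of a
translate grow polynomially, weakened here to exponentially. Summing the rates gives a common one.
-/
theorem expBounded_heatConv (T : 𝓢(Plane, ℝ) →L[ℝ] ℝ) {s : ℝ} (hs : 0 < s) :
    ExpBounded (heatConv T s) := by
  obtain ⟨S, C, hC, hT⟩ := exists_seminorm_bound T
  choose A hA0 hA using fun i : ℕ × ℕ => seminorm_compSubConst_le (heatTest s hs 0) i.1 i.2
  refine ⟨C * ∑ i ∈ S, A i, ∑ i ∈ S, (i.1 : ℝ),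
    mul_nonneg hC (Finset.sum_nonneg fun i _ => hA0 i), by positivity, fun x => ?_⟩
  rw [heatConv_eq T hs, mul_assoc, Finset.sum_mul]
  refine (hT _).trans (mul_le_mul_of_nonneg_left (Finset.sum_le_sum fun i hi => ?_) hC)
  refine (hA i x).trans ?_
  have := Finset.single_le_sum (f := fun i : ℕ × ℕ => (i.1 : ℝ)) (fun i _ => by positivity) hi
  have := hA0 i
  gcongr

/-! ### Second moments of white noise -/

section WhiteNoise

variable {Ω : Type*} [MeasurableSpace Ω] {P : Measure Ω} {η : Ω → (𝓢(Plane, ℝ) →L[ℝ] ℝ)}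

theorem IsWhiteNoise.memLp (hη : IsWhiteNoise P η) (φ : 𝓢(Plane, ℝ)) :
    MemLp (fun ω => η ω φ) 2 P := by
  have h1 : MemLp id 2 (P.map fun ω => η ω φ) := by
    rw [(hη φ).map_eq]
    exact memLp_id_gaussianReal' 2 (by simp)
  exact h1.comp_of_map (hη φ).aemeasurable

theorem IsWhiteNoise.integral_sq (hη : IsWhiteNoise P η) (φ : 𝓢(Plane, ℝ)) :
    ∫ ω, η ω φ ^ 2 ∂P = ∫ x, φ x ^ 2 := by
  have h0 : ∫ ω, η ω φ ∂P = 0 := by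
    rw [(hη φ).integral_eq, integral_id_gaussianReal]
  rw [← variance_of_integral_eq_zero (hη φ).aemeasurable h0, (hη φ).variance_eq,
    variance_id_gaussianReal, Real.coe_toNNReal _ (integral_nonneg fun x => sq_nonneg _)]

theorem IsWhiteNoise.integral_mul (hη : IsWhiteNoise P η) (φ ψ : 𝓢(Plane, ℝ)) :
    ∫ ω, η ω φ * η ω ψ ∂P = ∫ x, φ x * ψ x := by
  have h := hη.integral_sq (φ + ψ)
  have e1 : ∀ ω, η ω (φ + ψ) ^ 2 = η ω φ ^ 2 + 2 * (η ω φ * η ω ψ) + η ω ψ ^ 2 := fun ω => by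
    rw [map_add]; ring
  have e2 : ∀ x, (φ + ψ) x ^ 2 = φ x ^ 2 + 2 * (φ x * ψ x) + ψ x ^ 2 := fun x => by
    rw [add_apply]; ring
  simp_rw [e1, e2] at h
  have i1 := (hη.memLp φ).integrable_sq
  have i2 := (hη.memLp ψ).integrable_sq
  have i3 : Integrable (fun ω => η ω φ * η ω ψ) P := (hη.memLp φ).integrable_mul (hη.memLp ψ)
  have j1 := (φ.memLp 2 volume).integrable_sq
  have j2 := (ψ.memLp 2 volume).integrable_sq
  have j3 : Integrable (fun x => φ x * ψ x) := (φ.memLp 2 volume).integrable_mul (ψ.memLp 2 volume)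
  have i4 : Integrable (fun ω => η ω φ ^ 2 + 2 * (η ω φ * η ω ψ)) P := i1.add (i3.const_mul 2)
  have j4 : Integrable (fun x => φ x ^ 2 + 2 * (φ x * ψ x)) := j1.add (j3.const_mul 2)
  rw [integral_add i4 i2, integral_add i1 (i3.const_mul 2), integral_const_mul, integral_add j4 j2,
    integral_add j1 (j3.const_mul 2), integral_const_mul, hη.integral_sq, hη.integral_sq] at h
  linarith

theorem heatConv_of_pos (T : 𝓢(Plane, ℝ) →L[ℝ] ℝ) {s : ℝ} (hs : 0 < s) (x : Plane) :
    heatConv T s x = T (heatTest s hs x) := by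
  rw [heatConv, dif_pos hs]

theorem IsWhiteNoise.memLp_heatConv (hη : IsWhiteNoise P η) {s : ℝ} (hs : 0 < s) (x : Plane) :
    MemLp (fun ω => heatConv (η ω) s x) 2 P := by
  simp_rw [heatConv_of_pos _ hs]
  exact hη.memLp _

theorem IsWhiteNoise.integral_heatConv_mul (hη : IsWhiteNoise P η) {a b : ℝ} (ha : 0 < a)
    (hb : 0 < b) (x y : Plane) :
    ∫ ω, heatConv (η ω) a x * heatConv (η ω) b y ∂P = heatKernel (a + b) (x - y) := by
  simp_rw [heatConv_of_pos _ ha, heatConv_of_pos _ hb]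
  rw [hη.integral_mul, ← integral_heatKernel_mul_heatKernel ha hb]
  refine integral_congr_ae (ae_of_all _ fun z => ?_)
  change heatKernel a (x - z) * heatKernel b (y - z) = _
  rw [heatKernel_sub_comm b y z]

theorem IsWhiteNoise.integral_heatConv_sq (hη : IsWhiteNoise P η) {a : ℝ} (ha : 0 < a)
    (x : Plane) : ∫ ω, heatConv (η ω) a x ^ 2 ∂P = heatKernel (a + a) 0 := by
  simp_rw [sq]
  rw [hη.integral_heatConv_mul ha ha, sub_self]

/-- A random field with continuous paths is jointly almost everywhere measurable. -/
theorem aestronglyMeasurable_uncurry_of_continuous [SFinite P] {f : Plane → Ω → ℝ}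
    (hc : ∀ ω, Continuous fun y => f y ω) (hm : ∀ y, AEMeasurable (f y) P) :
    AEStronglyMeasurable (Function.uncurry f) ((volume : Measure Plane).prod P) := by
  set d := TopologicalSpace.denseSeq Plane
  set S : Set Ω := {ω | ∀ n, f (d n) ω = (hm (d n)).mk _ ω} with hS
  have hS0 : P Sᶜ = 0 := by
    have : ∀ᵐ ω ∂P, ω ∈ S := ae_all_iff.mpr fun n => (hm (d n)).ae_eq_mk
    exact this
  -- A measurable set of full measure on which the field agrees with measurable versions along a
  -- dense sequence. Cutting off outside `A` keeps the paths continuous, and limits along the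
  -- sequence make every value measurable.
  set A := (toMeasurable P Sᶜ)ᶜ with hA
  have hAm : MeasurableSet A := (measurableSet_toMeasurable P Sᶜ).compl
  have hAS : A ⊆ S := compl_subset_comm.mp (subset_toMeasurable P Sᶜ)
  have hA0 : ∀ᵐ ω ∂P, ω ∈ A := by
    rw [ae_iff]
    change P Aᶜ = 0
    rw [hA, compl_compl, measure_toMeasurable, hS0]
  set g : Plane → Ω → ℝ := fun y => A.indicator (f y) with hg
  have hgc : ∀ ω, Continuous fun y => g y ω := fun ω => by
    by_cases h : ω ∈ A
    · simpa [hg, h] using hc ω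
    · simpa [hg, h] using continuous_const
  have hgd : ∀ n, Measurable (g (d n)) := fun n => by
    have : g (d n) = A.indicator ((hm (d n)).mk _) :=
      indicator_congr fun ω hω => hAS hω n
    rw [this]
    exact (hm (d n)).measurable_mk.indicator hAm
  have hgm : ∀ y, Measurable (g y) := fun y => by
    obtain ⟨u, hu, hlim⟩ := mem_closure_iff_seq_limit.mp
      (TopologicalSpace.denseRange_denseSeq Plane y)
    choose k hk using hu
    refine measurable_of_tendsto_metrizable (f := fun n => g (u n)) (fun n => ?_) ?_
    · rw [← hk n]
      exact hgd _
    · exact tendsto_pi_nhds.mpr fun ω => ((hgc ω).tendsto y).comp hlim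
  have hmeas := measurable_uncurry_of_continuous_of_measurable hgc hgm
  refine hmeas.aestronglyMeasurable.congr ?_
  have h1 : ∀ᵐ p : Plane × Ω ∂((volume : Measure Plane).prod P), p.2 ∈ A :=
    Measure.quasiMeasurePreserving_snd.ae hA0
  filter_upwards [h1] with p hp
  simp [Function.uncurry, hg, hp]

theorem IsWhiteNoise.aestronglyMeasurable_heatConv [SFinite P] (hη : IsWhiteNoise P η) {s : ℝ}
    (hs : 0 < s) :
    AEStronglyMeasurable (fun p : Plane × Ω => heatConv (η p.2) s p.1)
      ((volume : Measure Plane).prod P) :=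
  aestronglyMeasurable_uncurry_of_continuous (f := fun y ω => heatConv (η ω) s y)
    (fun ω => continuous_heatConv (η ω) hs)
    fun y => (hη.memLp_heatConv hs y).aestronglyMeasurable.aemeasurable

theorem ExpBounded.sq {f : Plane → ℝ} (h : ExpBounded f) : ExpBounded (fun x => f x ^ 2) := by
  obtain ⟨C, l, hC, hl, hb⟩ := h
  refine ⟨C ^ 2, 2 * l, by positivity, by positivity, fun x => ?_⟩
  refine (abs_pow (f x) 2).trans_le ((pow_le_pow_left₀ (abs_nonneg _) (hb x) 2).trans_eq ?_)
  rw [mul_pow, ← Real.exp_nat_mul]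
  push_cast
  ring_nf

theorem ExpBounded.integrable_heatKernel_mul {f : Plane → ℝ} (hf : ExpBounded f)
    (hfc : Continuous f) {t : ℝ} (ht : 0 < t) (x : Plane) :
    Integrable (fun y => heatKernel t (x - y) * f y) := by
  refine ((hf.integrable_gaussian_mul hfc (a := 1 / (2 * t)) (by positivity) 0 x).const_mul
    (1 / (2 * π * t))).mono' (by fun_prop) (ae_of_all _ fun y => ?_)
  rw [norm_mul, Real.norm_eq_abs, abs_of_pos (heatKernel_pos ht _), heatKernel_eq,
    Real.norm_eq_abs, zero_mul, add_zero, mul_assoc]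

/-- Jensen's inequality for the probability density `p_t(x - ·)`, from the nonnegativity of the
variance. -/
theorem sq_heatSemigroup_le {f : Plane → ℝ} (hf : ExpBounded f) (hfc : Continuous f) {t : ℝ}
    (ht : 0 < t) (x : Plane) :
    heatSemigroup 0 t f x ^ 2 ≤ ∫ y, heatKernel t (x - y) * f y ^ 2 := by
  rw [heatSemigroup_of_pos ht]
  set c := ∫ y, heatKernel t (x - y) * f y with hc
  have i1 := hf.integrable_heatKernel_mul hfc ht x
  have i2 := hf.sq.integrable_heatKernel_mul (by fun_prop) ht x
  have i0 := integrable_heatKernel_sub ht x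
  have h1 : 0 ≤ ∫ y, heatKernel t (x - y) * (f y - c) ^ 2 :=
    integral_nonneg fun y => mul_nonneg (heatKernel_pos ht _).le (sq_nonneg _)
  have h2 : ∀ y, heatKernel t (x - y) * (f y - c) ^ 2 =
      heatKernel t (x - y) * f y ^ 2 - 2 * c * (heatKernel t (x - y) * f y) +
        c ^ 2 * heatKernel t (x - y) := fun y => by ring
  simp_rw [h2] at h1
  have i3 : Integrable (fun y => heatKernel t (x - y) * f y ^ 2 -
      2 * c * (heatKernel t (x - y) * f y)) := i2.sub (i1.const_mul _)
  rw [integral_add i3 (i0.const_mul _), integral_sub i2 (i1.const_mul _),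
    integral_const_mul, integral_const_mul, integral_heatKernel_sub ht, ← hc] at h1
  nlinarith

theorem lintegral_enorm_sq_eq {X : Ω → ℝ} (hX : MemLp X 2 P) :
    ∫⁻ ω, ‖X ω‖ₑ ^ 2 ∂P = ENNReal.ofReal (∫ ω, X ω ^ 2 ∂P) := by
  rw [ofReal_integral_eq_lintegral_ofReal hX.integrable_sq (ae_of_all _ fun ω => sq_nonneg _)]
  refine lintegral_congr fun ω => ?_
  rw [← sq_abs, ENNReal.ofReal_pow (abs_nonneg _), Real.enorm_eq_ofReal_abs]

/-- Jensen, then Tonelli: the second moment of `p_s ⋆ η` is the same at every point, and the heat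
kernel has mass one. The bound is uniform in `t` and `x`, as the uniqueness iteration requires. -/
theorem IsWhiteNoise.lintegral_heatSemigroup_abs_le [IsProbabilityMeasure P]
    (hη : IsWhiteNoise P η) {s t : ℝ} (hs : 0 < s) (ht : 0 ≤ t) (x : Plane) :
    ∫⁻ ω, ‖heatSemigroup 0 t (fun y => |heatConv (η ω) s y|) x‖ₑ ^ 2 ∂P ≤
      ENNReal.ofReal (heatKernel (s + s) 0) := by
  rcases ht.eq_or_lt with rfl | ht
  · simp only [heatSemigroup_zero, enorm_abs]
    rw [lintegral_enorm_sq_eq (hη.memLp_heatConv hs x), hη.integral_heatConv_sq hs]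
  have hm : AEMeasurable (Function.uncurry fun (ω : Ω) (y : Plane) =>
      ENNReal.ofReal (heatKernel t (x - y)) * ‖heatConv (η ω) s y‖ₑ ^ 2) (P.prod volume) := by
    have h1 := ((hη.aestronglyMeasurable_heatConv hs).prod_swap).enorm
    have h2 : Measurable fun p : Ω × Plane => ENNReal.ofReal (heatKernel t (x - p.2)) := by
      fun_prop
    exact h2.aemeasurable.mul (h1.pow_const 2)
  calc ∫⁻ ω, ‖heatSemigroup 0 t (fun y => |heatConv (η ω) s y|) x‖ₑ ^ 2 ∂P
      ≤ ∫⁻ ω, (∫⁻ y, ENNReal.ofReal (heatKernel t (x - y)) * ‖heatConv (η ω) s y‖ₑ ^ 2) ∂P := by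
        refine lintegral_mono fun ω => ?_
        have hb := (expBounded_heatConv (η ω) hs)
        have hc := (continuous_heatConv (η ω) hs)
        have h1 := sq_heatSemigroup_le hb.abs hc.abs ht x
        simp_rw [sq_abs] at h1
        calc ‖heatSemigroup 0 t (fun y => |heatConv (η ω) s y|) x‖ₑ ^ 2
            = ENNReal.ofReal (heatSemigroup 0 t (fun y => |heatConv (η ω) s y|) x ^ 2) := by
              rw [← sq_abs (heatSemigroup _ _ _ _), ENNReal.ofReal_pow (abs_nonneg _),
                Real.enorm_eq_ofReal_abs]
          _ ≤ ENNReal.ofReal (∫ y, heatKernel t (x - y) * heatConv (η ω) s y ^ 2) := by gcongr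
          _ = ∫⁻ y, ENNReal.ofReal (heatKernel t (x - y) * heatConv (η ω) s y ^ 2) :=
              ofReal_integral_eq_lintegral_ofReal
                (hb.sq.integrable_heatKernel_mul (by fun_prop) ht x)
                (ae_of_all _ fun y => mul_nonneg (heatKernel_pos ht _).le (sq_nonneg _))
          _ = _ := by
              refine lintegral_congr fun y => ?_
              rw [ENNReal.ofReal_mul (heatKernel_pos ht _).le, ← sq_abs,
                ENNReal.ofReal_pow (abs_nonneg _), Real.enorm_eq_ofReal_abs]
    _ = ∫⁻ y, ∫⁻ ω, ENNReal.ofReal (heatKernel t (x - y)) * ‖heatConv (η ω) s y‖ₑ ^ 2 ∂P :=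
        lintegral_lintegral_swap hm
    _ = ∫⁻ y, ENNReal.ofReal (heatKernel t (x - y)) * ENNReal.ofReal (heatKernel (s + s) 0) := by
        refine lintegral_congr fun y => ?_
        rw [lintegral_const_mul' _ _ (by simp), lintegral_enorm_sq_eq (hη.memLp_heatConv hs y),
          hη.integral_heatConv_sq hs]
    _ = ENNReal.ofReal (heatKernel (s + s) 0) := by
        rw [lintegral_mul_const' _ _ (by simp), ← ofReal_integral_eq_lintegral_ofReal
          (integrable_heatKernel_sub ht x) (ae_of_all _ fun y => (heatKernel_pos ht _).le),
          integral_heatKernel_sub ht, ENNReal.ofReal_one, one_mul]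

theorem IsWhiteNoise.memLp_heatSemigroup [IsProbabilityMeasure P] (hη : IsWhiteNoise P η)
    {s t : ℝ} (hs : 0 < s) (ht : 0 < t) (x : Plane) :
    MemLp (fun ω => heatSemigroup 0 t (heatConv (η ω) s) x) 2 P := by
  have hm : AEStronglyMeasurable (fun ω => heatSemigroup 0 t (heatConv (η ω) s) x) P := by
    simp_rw [heatSemigroup_of_pos ht]
    have h1 := (hη.aestronglyMeasurable_heatConv hs).prod_swap
    have h2 : Continuous fun y => heatKernel t (x - y) := by fun_prop
    have h3 : AEStronglyMeasurable (fun p : Ω × Plane => heatKernel t (x - p.2))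
      (P.prod volume) := (h2.measurable.comp measurable_snd).aestronglyMeasurable
    exact (h3.mul h1).integral_prod_right'
  refine ⟨hm, ?_⟩
  rw [eLpNorm_lt_top_iff_lintegral_rpow_enorm_lt_top (by simp) (by simp)]
  simp only [ENNReal.toReal_ofNat, ENNReal.rpow_ofNat]
  refine lt_of_le_of_lt (lintegral_mono fun ω => ?_)
    ((hη.lintegral_heatSemigroup_abs_le hs ht.le x).trans_lt ENNReal.ofReal_lt_top)
  gcongr
  rw [heatSemigroup_of_pos ht, heatSemigroup_of_pos ht]
  refine enorm_le_iff_norm_le.mpr ?_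
  rw [Real.norm_eq_abs (∫ y, heatKernel t (x - y) * |heatConv (η ω) s y|)]
  refine le_trans (norm_integral_le_integral_norm _) (le_trans (le_of_eq ?_) (le_abs_self _))
  refine integral_congr_ae (ae_of_all _ fun y => ?_)
  simp only [norm_mul, Real.norm_eq_abs, abs_of_pos (heatKernel_pos ht _)]

/-- Fubini, justified by `|W h| ≤ W² + h²` and by second moments of `h = p_s ⋆ η` independent of
`y`. -/
theorem IsWhiteNoise.integral_mul_heatSemigroup [IsProbabilityMeasure P] (hη : IsWhiteNoise P η)
    {s t : ℝ} (hs : 0 < s) (ht : 0 < t) (x : Plane) {W : Ω → ℝ} (hW : MemLp W 2 P) :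
    ∫ ω, W ω * heatSemigroup 0 t (heatConv (η ω) s) x ∂P =
      ∫ y, heatKernel t (x - y) * ∫ ω, W ω * heatConv (η ω) s y ∂P := by
  have hGm : AEStronglyMeasurable
      (fun p : Plane × Ω => heatKernel t (x - p.1) * (W p.2 * heatConv (η p.2) s p.1))
      ((volume : Measure Plane).prod P) := by
    have h2 : Continuous fun y => heatKernel t (x - y) := by fun_prop
    have h3 : AEStronglyMeasurable (fun p : Plane × Ω => heatKernel t (x - p.1))
      ((volume : Measure Plane).prod P) := (h2.measurable.comp measurable_fst).aestronglyMeasurable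
    exact h3.mul (hW.aestronglyMeasurable.comp_snd.mul (hη.aestronglyMeasurable_heatConv hs))
  have hprod : ∀ y, Integrable (fun ω => W ω * heatConv (η ω) s y) P := fun y =>
    hW.integrable_mul (hη.memLp_heatConv hs y)
  have hG : Integrable
      (fun p : Plane × Ω => heatKernel t (x - p.1) * (W p.2 * heatConv (η p.2) s p.1))
      ((volume : Measure Plane).prod P) := by
    refine (integrable_prod_iff hGm).mpr ⟨ae_of_all _ fun y => (hprod y).const_mul (heatKernel t (x - y)), ?_⟩
    refine ((integrable_heatKernel_sub ht x).mul_const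
      ((∫ ω, W ω ^ 2 ∂P) + heatKernel (s + s) 0)).mono' hGm.norm.integral_prod_right'
      (ae_of_all _ fun y => ?_)
    rw [Real.norm_eq_abs, abs_of_nonneg (integral_nonneg fun _ => norm_nonneg _)]
    simp only [norm_mul, Real.norm_eq_abs, abs_of_pos (heatKernel_pos ht _)]
    rw [integral_const_mul]
    refine mul_le_mul_of_nonneg_left ?_ (heatKernel_pos ht _).le
    rw [← hη.integral_heatConv_sq hs y,
      ← integral_add hW.integrable_sq (hη.memLp_heatConv hs y).integrable_sq]
    refine integral_mono ((hprod y).norm.congr (ae_of_all _ fun ω => ?_))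
      (hW.integrable_sq.add (hη.memLp_heatConv hs y).integrable_sq) fun ω => ?_
    · simp
    · have h1 := sq_nonneg (|W ω| - |heatConv (η ω) s y|)
      have h2 := sq_abs (W ω)
      have h3 := sq_abs (heatConv (η ω) s y)
      have h4 := sq_nonneg (W ω)
      have h5 := sq_nonneg (heatConv (η ω) s y)
      simp only
      nlinarith
  have hswap := integral_integral_swap (f := fun y ω =>
    heatKernel t (x - y) * (W ω * heatConv (η ω) s y)) hG
  simp_rw [integral_const_mul] at hswap
  rw [hswap]
  refine integral_congr_ae (ae_of_all _ fun ω => ?_)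
  simp only
  rw [heatSemigroup_of_pos ht, ← integral_const_mul]
  refine integral_congr_ae (ae_of_all _ fun y => ?_)
  simp only
  ring

/-- The semigroup property `P_t (p_s ⋆ η) = p_{t+s} ⋆ η`, almost surely at each point. -/
theorem IsWhiteNoise.heatSemigroup_heatConv [IsProbabilityMeasure P] (hη : IsWhiteNoise P η)
    {s t : ℝ} (hs : 0 < s) (ht : 0 ≤ t) (x : Plane) :
    (fun ω => heatSemigroup 0 t (heatConv (η ω) s) x) =ᵐ[P]
      fun ω => heatConv (η ω) (t + s) x := by
  rcases ht.eq_or_lt with rfl | ht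
  · exact ae_of_all _ fun ω => by simp [heatSemigroup_zero]
  set X : Ω → ℝ := fun ω => heatSemigroup 0 t (heatConv (η ω) s) x with hX
  set Y : Ω → ℝ := fun ω => heatConv (η ω) (t + s) x with hY
  have hXm : MemLp X 2 P := hη.memLp_heatSemigroup hs ht x
  have hYm : MemLp Y 2 P := hη.memLp_heatConv (by positivity) x
  have hDm : MemLp (X - Y) 2 P := hXm.sub hYm
  -- By Chapman-Kolmogorov, `X` and `Y` have the same covariance `p_{t+s+a}(x - z)` with every `p_a
  -- ⋆ η (z)`.
  have horth : ∀ {a : ℝ} (_ : 0 < a) (z : Plane),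
      ∫ ω, (X - Y) ω * heatConv (η ω) a z ∂P = 0 := fun {a} ha z => by
    have hWm := hη.memLp_heatConv ha z
    have h1 := hη.integral_mul_heatSemigroup hs ht x hWm
    simp_rw [hη.integral_heatConv_mul ha hs] at h1
    have h2 : ∫ y, heatKernel t (x - y) * heatKernel (a + s) (z - y) =
        heatKernel (t + (a + s)) (x - z) := by
      rw [← integral_heatKernel_mul_heatKernel ht (by positivity)]
      simp_rw [heatKernel_sub_comm (a + s) z]
    have h3 := hη.integral_heatConv_mul (show 0 < t + s by positivity) ha x z
    have h4 : ∫ ω, heatConv (η ω) a z * X ω ∂P = ∫ ω, Y ω * heatConv (η ω) a z ∂P := by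
      rw [hX, hY, h1, h2, h3]
      ring_nf
    have h5 : ∀ ω, (X - Y) ω * heatConv (η ω) a z =
        heatConv (η ω) a z * X ω - Y ω * heatConv (η ω) a z := fun ω => by
      rw [Pi.sub_apply]; ring
    simp_rw [h5]
    have i1 : Integrable (fun ω => heatConv (η ω) a z * X ω) P := hWm.integrable_mul hXm
    have i2 : Integrable (fun ω => Y ω * heatConv (η ω) a z) P := hYm.integrable_mul hWm
    rw [integral_sub i1 i2, h4, sub_self]
  -- `X` averages the values of `p_s ⋆ η`, and `Y` is itself a value of `p_{t+s} ⋆ η`, so `X - Y` is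
  -- orthogonal to both and hence to itself.
  have hzero : ∫ ω, (X - Y) ω ^ 2 ∂P = 0 := by
    have h1 := hη.integral_mul_heatSemigroup hs ht x hDm
    simp_rw [horth hs] at h1
    have h2 := horth (show 0 < t + s by positivity) x
    have h3 : ∀ ω, (X - Y) ω ^ 2 = (X - Y) ω * X ω - (X - Y) ω * Y ω := fun ω => by
      rw [Pi.sub_apply]; ring
    simp_rw [h3]
    have i1 : Integrable (fun ω => (X - Y) ω * X ω) P := hDm.integrable_mul hXm
    have i2 : Integrable (fun ω => (X - Y) ω * Y ω) P := hDm.integrable_mul hYm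
    rw [integral_sub i1 i2, h1, h2]
    simp
  have h := (integral_eq_zero_iff_of_nonneg (fun ω => sq_nonneg _) hDm.integrable_sq).mp hzero
  filter_upwards [h] with ω hω
  have : (X - Y) ω = 0 := by simpa using hω
  exact sub_eq_zero.mp this

end WhiteNoise

/-! ### The scalar ordinary differential equations -/

theorem HasDerivAt.one_div_sqrt {f : ℝ → ℝ} {f' x : ℝ} (h : HasDerivAt f f' x) (hx : 0 < f x) :
    HasDerivAt (fun y => 1 / √(f y)) (-(1 / 2) * f' * (1 / √(f x)) ^ 3) x := by
  have h1 := (h.sqrt hx.ne').inv (Real.sqrt_pos.mpr hx).ne'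
  simp only [one_div]
  refine HasDerivAt.congr_deriv h1 ?_
  have := (Real.sqrt_pos.mpr hx).ne'
  field_simp

theorem sigma_zero : sigma 0 = 1 := by simp [sigma]

theorem hasDerivAt_sigma {ζ : ℝ} (hζ : 0 ≤ ζ) :
    HasDerivAt sigma (-(3 / (2 * π)) * sigma ζ ^ 3) ζ := by
  have h1 : HasDerivAt (fun ζ : ℝ => 1 + 3 / π * ζ) (3 / π) ζ := by
    simpa using ((hasDerivAt_id ζ).const_mul (3 / π)).const_add 1
  refine (HasDerivAt.one_div_sqrt h1 (by positivity)).congr_deriv ?_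
  rw [sigma]
  ring

section ScalarCoefficients

variable {ε : ℝ} (m : ℝ)

theorem log_one_div_pos (hε : 0 < ε) (hε' : ε < 1 / 2) : 0 < Real.log (1 / ε) :=
  Real.log_pos (by rw [lt_div_iff₀ hε]; linarith)

/-- The open half-line `(-ε², ∞)` contains `[0, ∞)`, so derivatives at time zero are two-sided. -/
theorem contDiffOn_cEps_integrand : ContDiffOn ℝ (⊤ : ℕ∞)
    (fun s : ℝ => Real.exp (2 * m * s) / (s + ε ^ 2)) (Ioi (-ε ^ 2)) := by
  have h1 : ContDiffOn ℝ (⊤ : ℕ∞) (fun s : ℝ => Real.exp (2 * m * s)) (Ioi (-ε ^ 2)) := by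
    fun_prop
  have h2 : ContDiffOn ℝ (⊤ : ℕ∞) (fun s : ℝ => s + ε ^ 2) (Ioi (-ε ^ 2)) := by fun_prop
  exact h1.div h2 fun s (hs : -ε ^ 2 < s) => by linarith

theorem intervalIntegrable_cEps_integrand (hε : 0 < ε) {t : ℝ} (ht : -ε ^ 2 < t) :
    IntervalIntegrable (fun s : ℝ => Real.exp (2 * m * s) / (s + ε ^ 2)) volume 0 t := by
  refine ((contDiffOn_cEps_integrand m).continuousOn.mono fun s hs => ?_).intervalIntegrable
  have h1 : -ε ^ 2 < min 0 t := lt_min (by have := pow_pos hε 2; linarith) ht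
  exact h1.trans_le hs.1

theorem hasDerivAt_cEps (hε : 0 < ε) {t : ℝ} (ht : -ε ^ 2 < t) :
    HasDerivAt (cEps m ε)
      (1 / (2 * Real.log (1 / ε)) * (Real.exp (2 * m * t) / (t + ε ^ 2))) t := by
  refine HasDerivAt.const_mul _ (intervalIntegral.integral_hasDerivAt_right
    (intervalIntegrable_cEps_integrand m hε ht) ?_ ?_)
  · have : Measurable fun s : ℝ => Real.exp (2 * m * s) / (s + ε ^ 2) := by fun_prop
    exact this.stronglyMeasurable.stronglyMeasurableAtFilter
  · exact (contDiffOn_cEps_integrand m).continuousOn.continuousAt (Ioi_mem_nhds ht)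

theorem contDiffOn_cEps (hε : 0 < ε) : ContDiffOn ℝ (⊤ : ℕ∞) (cEps m ε) (Ioi (-ε ^ 2)) := by
  refine (contDiffOn_infty_iff_deriv_of_isOpen isOpen_Ioi).mpr
    ⟨fun t ht => (hasDerivAt_cEps m hε ht).differentiableAt.differentiableWithinAt, ?_⟩
  exact (contDiffOn_const.mul (contDiffOn_cEps_integrand m)).congr
    fun t ht => (hasDerivAt_cEps m hε ht).deriv

theorem cEps_nonneg (hε : 0 < ε) (hε' : ε < 1 / 2) {t : ℝ} (ht : 0 ≤ t) : 0 ≤ cEps m ε t := by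
  have := log_one_div_pos hε hε'
  refine mul_nonneg (by positivity) (intervalIntegral.integral_nonneg ht fun s hs => ?_)
  have := hs.1
  positivity

theorem one_le_sigmaEps_radicand (lam : ℝ) (hε : 0 < ε) (hε' : ε < 1 / 2) {t : ℝ} (ht : 0 ≤ t) :
    1 ≤ 1 + 3 * lam ^ 2 / π * cEps m ε t := by
  have := cEps_nonneg m hε hε' ht
  have : 0 ≤ 3 * lam ^ 2 / π * cEps m ε t := by positivity
  linarith

theorem Ici_zero_subset_Ioi (hε : 0 < ε) : Ici (0 : ℝ) ⊆ Ioi (-ε ^ 2) := fun t (ht : 0 ≤ t) => by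
  have := pow_pos hε 2
  exact show -ε ^ 2 < t by linarith

/-- The scalar factor `lam σ_{lam,ε}(t) e^{mt}` in the explicit solution. -/
def amplitude (m lam ε t : ℝ) : ℝ := lam * sigmaEps m lam ε t * Real.exp (m * t)

theorem explicitSolution_eq {Ω : Type*} (η : Ω → (𝓢(Plane, ℝ) →L[ℝ] ℝ)) (m lam ε t : ℝ)
    (x : Plane) (ω : Ω) : explicitSolution η m lam ε t x ω =
      amplitude m lam ε t * heatSemigroup 0 t (heatConv (η ω) (ε ^ 2)) x := by
  rw [explicitSolution, heatSemigroup_eq_exp_mul, amplitude]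
  ring

theorem sigmaEps_zero (lam : ℝ) : sigmaEps m lam ε 0 = 1 := by
  simp [sigmaEps, cEps]

theorem continuousOn_amplitude (lam : ℝ) (hε : 0 < ε) (hε' : ε < 1 / 2) :
    ContinuousOn (amplitude m lam ε) (Ici 0) := by
  have h1 := (contDiffOn_cEps m hε).continuousOn.mono (Ici_zero_subset_Ioi hε)
  have h2 : ContinuousOn (sigmaEps m lam ε) (Ici 0) := by
    refine continuousOn_const.div (continuousOn_const.add (continuousOn_const.mul h1)).sqrt
      fun t ht => ?_
    exact (Real.sqrt_pos.mpr (one_pos.trans_le (one_le_sigmaEps_radicand m lam hε hε' ht))).ne'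
  exact (continuousOn_const.mul h2).mul (by fun_prop)

theorem contDiffOn_amplitude (lam : ℝ) (hε : 0 < ε) (hε' : ε < 1 / 2) :
    ContDiffOn ℝ (⊤ : ℕ∞) (amplitude m lam ε) (Ioi 0) := by
  have h1 := (contDiffOn_cEps m hε).mono (Ioi_subset_Ici_self.trans (Ici_zero_subset_Ioi hε))
  have h3 : ∀ t ∈ Ioi (0 : ℝ), 0 < 1 + 3 * lam ^ 2 / π * cEps m ε t := fun t ht =>
    one_pos.trans_le (one_le_sigmaEps_radicand m lam hε hε' (le_of_lt ht))
  have h2 : ContDiffOn ℝ (⊤ : ℕ∞) (sigmaEps m lam ε) (Ioi 0) := by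
    refine contDiffOn_const.div ((contDiffOn_const.add (contDiffOn_const.mul h1)).sqrt
      fun t ht => (h3 t ht).ne') fun t ht => (Real.sqrt_pos.mpr (h3 t ht)).ne'
  exact (contDiffOn_const.mul h2).mul (by fun_prop)

/-- The Bernoulli equation: differentiating `σ` produces `σ³ lam² e^{2mt} / (t + ε²)`, whose
constant matches through `p_{2(t+ε²)}(0) = 1/(4π(t+ε²))`. -/
theorem hasDerivAt_amplitude (lam : ℝ) (hε : 0 < ε) (hε' : ε < 1 / 2) {t : ℝ} (ht : 0 ≤ t) :
    HasDerivAt (amplitude m lam ε) (m * amplitude m lam ε t -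
      3 / Real.log (1 / ε) * (amplitude m lam ε t ^ 2 *
        heatKernel ((t + ε ^ 2) + (t + ε ^ 2)) 0) * amplitude m lam ε t) t := by
  have hL := log_one_div_pos hε hε'
  have h1 := ((hasDerivAt_cEps m hε (Ici_zero_subset_Ioi hε ht)).const_mul
    (3 * lam ^ 2 / π)).const_add 1
  have h2 : HasDerivAt (sigmaEps m lam ε) _ t := HasDerivAt.one_div_sqrt h1
    (one_pos.trans_le (one_le_sigmaEps_radicand m lam hε hε' ht))
  have h3 : HasDerivAt (fun t => Real.exp (m * t)) (Real.exp (m * t) * m) t := by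
    simpa using ((hasDerivAt_id t).const_mul m).exp
  have h4 : Real.exp (2 * m * t) = Real.exp (m * t) ^ 2 := by
    rw [← Real.exp_nat_mul]
    push_cast
    ring_nf
  refine ((h2.const_mul lam).mul h3).congr_deriv ?_
  rw [heatKernel_zero, h4, amplitude]
  change lam * (_ * sigmaEps m lam ε t ^ 3) * _ + _ = _
  have : 0 < t + ε ^ 2 := by positivity
  field_simp
  ring

end ScalarCoefficients

/-! ### Exponential growth -/

/-- The rate is raised to `l + 1` because `ExpGrowth` asks for a positive one, while `l` may be
zero. -/
theorem expGrowth_of_le {f : Plane → ℝ≥0∞} {C l : ℝ} (hC : 0 ≤ C) (hl : 0 ≤ l)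
    (h : ∀ x, f x ≤ ENNReal.ofReal (C * Real.exp (l * ‖x‖))) : ExpGrowth f := by
  refine ⟨l + 1, by positivity, lt_of_le_of_lt (iSup_le fun x => ?_)
    (ENNReal.ofReal_lt_top (r := C))⟩
  calc f x * ENNReal.ofReal (Real.exp (-(l + 1) * ‖x‖))
      ≤ ENNReal.ofReal (C * Real.exp (l * ‖x‖)) * ENNReal.ofReal (Real.exp (-(l + 1) * ‖x‖)) := by
        gcongr
        exact h x
    _ = ENNReal.ofReal (C * Real.exp (-‖x‖)) := by
        rw [← ENNReal.ofReal_mul (by positivity), mul_assoc, ← Real.exp_add]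
        ring_nf
    _ ≤ ENNReal.ofReal C := ENNReal.ofReal_le_ofReal (mul_le_of_le_one_right hC
        (Real.exp_le_one_iff.mpr (neg_nonpos.mpr (norm_nonneg x))))

theorem ExpGrowth.exists_le {f : Plane → ℝ≥0∞} (h : ExpGrowth f) :
    ∃ C l : ℝ, 0 ≤ C ∧ 0 ≤ l ∧ ∀ x, f x ≤ ENNReal.ofReal (C * Real.exp (l * ‖x‖)) := by
  obtain ⟨l, hl, h⟩ := h
  set S := ⨆ x, f x * ENNReal.ofReal (Real.exp (-l * ‖x‖)) with hS
  refine ⟨S.toReal, l, ENNReal.toReal_nonneg, hl.le, fun x => ?_⟩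
  have h1 : f x * ENNReal.ofReal (Real.exp (-l * ‖x‖)) ≤ S :=
    le_iSup (fun x => f x * ENNReal.ofReal (Real.exp (-l * ‖x‖))) x
  have h2 : ENNReal.ofReal (Real.exp (-l * ‖x‖)) * ENNReal.ofReal (Real.exp (l * ‖x‖)) = 1 := by
    rw [← ENNReal.ofReal_mul (Real.exp_pos _).le, ← Real.exp_add]
    simp
  calc f x = f x * ENNReal.ofReal (Real.exp (-l * ‖x‖)) * ENNReal.ofReal (Real.exp (l * ‖x‖)) := by
        rw [mul_assoc, h2, mul_one]
    _ ≤ S * ENNReal.ofReal (Real.exp (l * ‖x‖)) := by gcongr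
    _ = _ := by
        rw [ENNReal.ofReal_mul ENNReal.toReal_nonneg, ENNReal.ofReal_toReal h.ne]

theorem IsSpaceTimeRegular.expGrowth {w : ℝ → Plane → ℝ} (h : IsSpaceTimeRegular w) {T : ℝ}
    (hT : 0 < T) : ExpGrowth (fun x => ⨆ s ∈ Icc (0 : ℝ) T, ‖w s x‖ₑ) := by
  obtain ⟨C, l, hC, hl, hb⟩ := h.growth T hT
  refine expGrowth_of_le hC hl fun x => iSup₂_le fun s hs => ?_
  rw [Real.enorm_eq_ofReal_abs]
  exact ENNReal.ofReal_le_ofReal (hb s hs x)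

/-! ### The explicit solution -/

theorem isSpaceTimeRegular_explicitSolution {Ω : Type*}
    (η : Ω → (𝓢(Plane, ℝ) →L[ℝ] ℝ)) (m lam : ℝ) {ε : ℝ} (hε : 0 < ε) (hε' : ε < 1 / 2) (ω : Ω) :
    IsSpaceTimeRegular (fun t x => explicitSolution η m lam ε t x ω) := by
  simp_rw [explicitSolution_eq]
  exact (isSpaceTimeRegular_heatSemigroup (expBounded_heatConv (η ω) (by positivity))
    (continuous_heatConv (η ω) (by positivity))).mul_time (continuousOn_amplitude m lam hε hε')
    (contDiffOn_amplitude m lam hε hε')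

section Explicit

variable {Ω : Type*} [MeasurableSpace Ω] {P : Measure Ω} {η : Ω → (𝓢(Plane, ℝ) →L[ℝ] ℝ)}

theorem IsWhiteNoise.explicitSolution_ae_eq [IsProbabilityMeasure P] (hη : IsWhiteNoise P η)
    (m lam : ℝ) {ε : ℝ} (hε : 0 < ε) {t : ℝ} (ht : 0 ≤ t) (x : Plane) :
    explicitSolution η m lam ε t x =ᵐ[P]
      fun ω => amplitude m lam ε t * heatConv (η ω) (t + ε ^ 2) x := by
  filter_upwards [hη.heatSemigroup_heatConv (show 0 < ε ^ 2 by positivity) ht x] with ω hω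
  rw [explicitSolution_eq, hω]

theorem IsWhiteNoise.memLp_explicitSolution [IsProbabilityMeasure P] (hη : IsWhiteNoise P η)
    (m lam : ℝ) {ε : ℝ} (hε : 0 < ε) {t : ℝ} (ht : 0 ≤ t) (x : Plane) :
    MemLp (explicitSolution η m lam ε t x) 2 P :=
  ((hη.memLp_heatConv (show 0 < t + ε ^ 2 by positivity) x).const_mul _).ae_eq
    (hη.explicitSolution_ae_eq m lam hε ht x).symm

theorem IsWhiteNoise.integral_explicitSolution_sq [IsProbabilityMeasure P]
    (hη : IsWhiteNoise P η) (m lam : ℝ) {ε : ℝ} (hε : 0 < ε) {t : ℝ} (ht : 0 ≤ t) (x : Plane) :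
    ∫ ω, explicitSolution η m lam ε t x ω ^ 2 ∂P =
      amplitude m lam ε t ^ 2 * heatKernel ((t + ε ^ 2) + (t + ε ^ 2)) 0 := by
  rw [← hη.integral_heatConv_sq (show 0 < t + ε ^ 2 by positivity) x, ← integral_const_mul]
  refine integral_congr_ae ?_
  filter_upwards [hη.explicitSolution_ae_eq m lam hε ht x] with ω hω
  rw [hω, mul_pow]

theorem IsWhiteNoise.isMcKeanVlasovSolution_explicitSolution [IsProbabilityMeasure P]
    (hη : IsWhiteNoise P η) (m lam : ℝ) {ε : ℝ} (hε : 0 < ε) (hε' : ε < 1 / 2) :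
    IsMcKeanVlasovSolution P η m lam ε (explicitSolution η m lam ε) where
  aemeasurable t ht x := (hη.memLp_explicitSolution m lam hε ht x).aestronglyMeasurable.aemeasurable
  initial := ae_of_all _ fun ω x => by
    rw [explicitSolution_eq, heatSemigroup_zero, amplitude, sigmaEps_zero]
    simp
  continuous := ae_of_all _ fun ω =>
    (isSpaceTimeRegular_explicitSolution η m lam hε hε' ω).continuousOn
  smooth := ae_of_all _ fun ω =>
    (isSpaceTimeRegular_explicitSolution η m lam hε hε' ω).contDiffOn
  equation := ae_of_all _ fun ω t ht x => by
    have hb := expBounded_heatConv (η ω) (show 0 < ε ^ 2 by positivity)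
    have hc := continuous_heatConv (η ω) (show 0 < ε ^ 2 by positivity)
    have hreg := isSpaceTimeRegular_heatSemigroup hb hc
    rw [hη.integral_explicitSolution_sq m lam hε ht.le x]
    simp_rw [explicitSolution_eq]
    have h1 : HasDerivAt (fun s => amplitude m lam ε s *
        heatSemigroup 0 s (heatConv (η ω) (ε ^ 2)) x) _ t :=
      (hasDerivAt_amplitude m lam hε hε' ht.le).mul (hreg.differentiableAt_time ht x).hasDerivAt
    rw [h1.deriv, deriv_heatSemigroup hb hc ht, hreg.laplacian_const_mul _ ht x]
    ring
  growth := ae_of_all _ fun ω T hT =>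
    (isSpaceTimeRegular_explicitSolution η m lam hε hε' ω).expGrowth hT
  moment_growth T hT := by
    obtain ⟨K, hK⟩ := isCompact_Icc.exists_bound_of_continuousOn
      ((continuousOn_amplitude m lam hε hε').mono (Icc_subset_Ici_self : Icc 0 T ⊆ Ici 0))
    have hk := heatKernel_pos (show 0 < ε ^ 2 + ε ^ 2 by positivity) 0
    refine expGrowth_of_le (C := K ^ 2 * heatKernel (ε ^ 2 + ε ^ 2) 0) (l := 0) (by positivity)
      le_rfl fun x => iSup₂_le fun s hs => ?_
    rw [lintegral_enorm_sq_eq (hη.memLp_explicitSolution m lam hε hs.1 x),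
      hη.integral_explicitSolution_sq m lam hε hs.1 x]
    refine ENNReal.ofReal_le_ofReal ?_
    have h1 : amplitude m lam ε s ^ 2 ≤ K ^ 2 := by
      rw [← sq_abs]
      exact pow_le_pow_left₀ (abs_nonneg _) (hK s hs) 2
    have h2 : heatKernel ((s + ε ^ 2) + (s + ε ^ 2)) 0 ≤ heatKernel (ε ^ 2 + ε ^ 2) 0 := by
      have := hs.1
      rw [heatKernel_zero, heatKernel_zero]
      gcongr <;> linarith
    have := (heatKernel_pos (show 0 < (s + ε ^ 2) + (s + ε ^ 2) by
      have := hs.1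
      positivity) 0).le
    rw [zero_mul, Real.exp_zero, mul_one]
    gcongr

end Explicit

/-! ### Pathwise comparison -/

section Comparison

variable {v u Z gv gu : ℝ → Plane → ℝ} {m α : ℝ}

/-- With the second moment frozen as a potential `gv`, the equation is linear. Where `v > Z ≥ 0` the
potential term only lowers `v`, so `v - Z` is a subsolution there. -/
theorem IsSpaceTimeRegular.le_of_potential_nonneg (hv : IsSpaceTimeRegular v)
    (hZ : IsSpaceTimeRegular Z) (hα : 0 ≤ α) (hg : ∀ t x, 0 ≤ gv t x) (hZ0 : ∀ t, 0 ≤ t → ∀ x, 0 ≤ Z t x)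
    (h0 : ∀ x, v 0 x ≤ Z 0 x)
    (hve : ∀ t, 0 < t → ∀ x, deriv (fun s => v s x) t =
      1 / 2 * (Δ (v t)) x + m * v t x - α * gv t x * v t x)
    (hZe : ∀ t, 0 < t → ∀ x, deriv (fun s => Z s x) t = 1 / 2 * (Δ (Z t)) x + m * Z t x)
    {t : ℝ} (ht : 0 ≤ t) (x : Plane) : v t x ≤ Z t x := by
  refine sub_nonpos.mp ((hv.sub hZ).nonpos_of_subsolution m (fun y => sub_nonpos.mpr (h0 y)) ht
    (fun s hs _ y hy => ?_) x)
  have hd : HasDerivAt (fun s => v s y - Z s y) _ s :=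
    (hv.differentiableAt_time hs y).hasDerivAt.sub (hZ.differentiableAt_time hs y).hasDerivAt
  rw [hd.deriv, hve s hs y, hZe s hs y, hv.laplacian_sub hZ hs y]
  have h1 : 0 < v s y := by linarith [hZ0 s hs.le y]
  have := mul_nonneg (mul_nonneg hα (hg s y)) h1.le
  linarith

/-- One step of the uniqueness iteration. Split `gv v - gu u = gv (v - u) + (gv - gu) u`: where `v -
u > 0` the first part has a favourable sign, and the second is at most `γ sⁿ Z` in absolute value.
-/
theorem IsSpaceTimeRegular.sub_le_of_potential_close (hv : IsSpaceTimeRegular v)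
    (hu : IsSpaceTimeRegular u) (hZ : IsSpaceTimeRegular Z) (hα : 0 ≤ α)
    (hg : ∀ t x, 0 ≤ gv t x) (hZ0 : ∀ t, 0 ≤ t → ∀ x, 0 ≤ Z t x) (h0 : ∀ x, v 0 x = u 0 x)
    (hve : ∀ t, 0 < t → ∀ x, deriv (fun s => v s x) t =
      1 / 2 * (Δ (v t)) x + m * v t x - α * gv t x * v t x)
    (hue : ∀ t, 0 < t → ∀ x, deriv (fun s => u s x) t =
      1 / 2 * (Δ (u t)) x + m * u t x - α * gu t x * u t x)
    (hZe : ∀ t, 0 < t → ∀ x, deriv (fun s => Z s x) t = 1 / 2 * (Δ (Z t)) x + m * Z t x)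
    (huZ : ∀ t, 0 < t → ∀ x, |u t x| ≤ Z t x) {t γ : ℝ} (ht : 0 ≤ t) (hγ : 0 ≤ γ) (n : ℕ)
    (hclose : ∀ s, 0 < s → s ≤ t → ∀ x, |gv s x - gu s x| ≤ γ * s ^ n) (x : Plane) :
    v t x - u t x ≤ α * γ * t ^ (n + 1) / (n + 1) * Z t x := by
  -- Chosen with `b(0) = 0` and `b' = α γ sⁿ`, so that the time derivative of `b Z` absorbs the
  -- error.
  set b : ℝ → ℝ := fun s => α * γ * s ^ (n + 1) / (n + 1) with hb
  have hbZ := hZ.mul_time (a := b) (by fun_prop) (by fun_prop)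
  refine sub_nonpos.mp (((hv.sub hu).sub hbZ).nonpos_of_subsolution m (fun y => ?_) ht
    (fun s hs hst y hy => ?_) x)
  · simp [hb, h0]
  have hbd : HasDerivAt b (α * γ * s ^ n) s := by
    have := ((hasDerivAt_pow (n + 1) s).const_mul (α * γ)).div_const ((n : ℝ) + 1)
    refine this.congr_deriv ?_
    push_cast
    field_simp
  have hd : HasDerivAt (fun s => v s y - u s y - b s * Z s y) _ s :=
    ((hv.differentiableAt_time hs y).hasDerivAt.sub (hu.differentiableAt_time hs y).hasDerivAt).sub
      (hbd.mul (hZ.differentiableAt_time hs y).hasDerivAt)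
  rw [hd.deriv, hve s hs y, hue s hs y, hZe s hs y, (hv.sub hu).laplacian_sub hbZ hs y,
    hv.laplacian_sub hu hs y, hZ.laplacian_const_mul _ hs y]
  have hbs : 0 ≤ b s := by
    simp only [hb]
    positivity
  have h1 : 0 < v s y - u s y := by linarith [mul_nonneg hbs (hZ0 s hs.le y)]
  have h2 := mul_nonneg (mul_nonneg hα (hg s y)) h1.le
  have h3 : -((gv s y - gu s y) * u s y) ≤ γ * s ^ n * Z s y := by
    refine (neg_le_abs _).trans ?_
    rw [abs_mul]
    exact mul_le_mul (hclose s hs hst y) (huZ s hs y) (abs_nonneg _) (by positivity)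
  have h4 := mul_le_mul_of_nonneg_left h3 hα
  nlinarith

end Comparison

/-! ### Uniqueness -/

/-- The solution of the heat equation with mass `m` started from `|lam • (p_{ε²} ⋆ η)|`, `lam > 0`,
which dominates every solution of the McKean-Vlasov equation. -/
def dominatingField {Ω : Type*} (η : Ω → (𝓢(Plane, ℝ) →L[ℝ] ℝ)) (m lam ε t : ℝ)
    (x : Plane) (ω : Ω) : ℝ :=
  lam * Real.exp (m * t) * heatSemigroup 0 t (fun y => |heatConv (η ω) (ε ^ 2) y|) x

theorem isSpaceTimeRegular_dominatingField {Ω : Type*} (η : Ω → (𝓢(Plane, ℝ) →L[ℝ] ℝ))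
    (m lam : ℝ) {ε : ℝ} (hε : 0 < ε) (ω : Ω) : IsSpaceTimeRegular (fun t x => dominatingField η m lam ε t x ω) :=
  (isSpaceTimeRegular_heatSemigroup (expBounded_heatConv (η ω) (by positivity)).abs
    (continuous_heatConv (η ω) (by positivity)).abs).mul_time (by fun_prop) (by fun_prop)

theorem dominatingField_nonneg {Ω : Type*} (η : Ω → (𝓢(Plane, ℝ) →L[ℝ] ℝ)) (m : ℝ) {lam ε t : ℝ}
    (hlam : 0 ≤ lam) (ht : 0 ≤ t) (x : Plane) (ω : Ω) : 0 ≤ dominatingField η m lam ε t x ω := by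
  rw [dominatingField, heatSemigroup_eq_integral_scaled ht]
  exact mul_nonneg (by positivity) (integral_nonneg fun z =>
    mul_nonneg (heatKernel_pos one_pos z).le (abs_nonneg _))

theorem dominatingField_zero {Ω : Type*} (η : Ω → (𝓢(Plane, ℝ) →L[ℝ] ℝ)) (m : ℝ) {lam : ℝ}
    (hlam : 0 ≤ lam) (ε : ℝ) (x : Plane) (ω : Ω) :
    dominatingField η m lam ε 0 x ω = |lam * heatConv (η ω) (ε ^ 2) x| := by
  rw [dominatingField, heatSemigroup_zero, abs_mul, abs_of_nonneg hlam]
  simp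

theorem deriv_dominatingField {Ω : Type*} (η : Ω → (𝓢(Plane, ℝ) →L[ℝ] ℝ)) (m lam : ℝ) {ε : ℝ}
    (hε : 0 < ε) (ω : Ω) {t : ℝ} (ht : 0 < t) (x : Plane) :
    deriv (fun s => dominatingField η m lam ε s x ω) t =
      1 / 2 * (Δ fun y => dominatingField η m lam ε t y ω) x +
        m * dominatingField η m lam ε t x ω := by
  have hb := (expBounded_heatConv (η ω) (show 0 < ε ^ 2 by positivity)).abs
  have hc := (continuous_heatConv (η ω) (show 0 < ε ^ 2 by positivity)).abs
  have hreg := isSpaceTimeRegular_heatSemigroup hb hc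
  have h1 : HasDerivAt (fun s => lam * Real.exp (m * s)) (lam * (Real.exp (m * t) * m)) t := by
    simpa using (((hasDerivAt_id t).const_mul m).exp).const_mul lam
  have h2 : HasDerivAt (fun s => dominatingField η m lam ε s x ω) _ t :=
    h1.mul (hreg.differentiableAt_time ht x).hasDerivAt
  rw [h2.deriv, deriv_heatSemigroup hb hc ht]
  simp only [dominatingField]
  rw [hreg.laplacian_const_mul _ ht x]
  ring

section Uniqueness

variable {Ω : Type*} [MeasurableSpace Ω] {P : Measure Ω} {η : Ω → (𝓢(Plane, ℝ) →L[ℝ] ℝ)}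
  {m α lam ε : ℝ}

theorem IsSolution.isSpaceTimeRegular {v₀ : Plane → Ω → ℝ} {v : ℝ → Plane → Ω → ℝ}
    (h : IsSolution P m α v₀ v) : ∀ᵐ ω ∂P, IsSpaceTimeRegular (fun t x => v t x ω) := by
  filter_upwards [h.continuous, h.smooth, h.growth] with ω h1 h2 h3
  refine ⟨h1, h2, fun T hT => ?_⟩
  obtain ⟨C, l, hC, hl, hb⟩ := (h3 T hT).exists_le
  refine ⟨C, l, hC, hl, fun t ht x => ?_⟩
  have h4 : ‖v t x ω‖ₑ ≤ ENNReal.ofReal (C * Real.exp (l * ‖x‖)) :=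
    (le_iSup₂ (f := fun s (_ : s ∈ Icc (0 : ℝ) T) => ‖v s x ω‖ₑ) t ht).trans (hb x)
  rw [Real.enorm_eq_ofReal_abs] at h4
  exact (ENNReal.ofReal_le_ofReal_iff (by positivity)).mp h4

theorem IsWhiteNoise.lintegral_dominatingField_le [IsProbabilityMeasure P]
    (hη : IsWhiteNoise P η) (m : ℝ) (hlam : 0 ≤ lam) (hε : 0 < ε) {t T : ℝ} (ht : 0 ≤ t)
    (htT : t ≤ T) (x : Plane) :
    ∫⁻ ω, ‖dominatingField η m lam ε t x ω‖ₑ ^ 2 ∂P ≤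
      ENNReal.ofReal ((lam * Real.exp (|m| * T)) ^ 2 * heatKernel (ε ^ 2 + ε ^ 2) 0) := by
  simp only [dominatingField, enorm_mul _ (heatSemigroup _ _ _ _), mul_pow]
  rw [lintegral_const_mul' _ _ (ENNReal.pow_ne_top enorm_ne_top), ENNReal.ofReal_mul (by positivity)]
  refine mul_le_mul' ?_ (hη.lintegral_heatSemigroup_abs_le (by positivity) ht x)
  rw [Real.enorm_eq_ofReal_abs, ← ENNReal.ofReal_pow (abs_nonneg _),
    abs_of_nonneg (by positivity), ← mul_pow]
  have h1 : m * t ≤ |m| * T := by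
    have := le_abs_self m
    have := abs_nonneg m
    nlinarith
  gcongr

theorem three_div_log_nonneg (hε : 0 < ε) (hε' : ε < 1 / 2) : 0 ≤ 3 / Real.log (1 / ε) := by
  have := log_one_div_pos hε hε'
  positivity

/-- The comparison is applied to `v` and to `-v`, which solves the same linear equation once the
second moment is frozen. -/
theorem IsMcKeanVlasovSolution.abs_le_dominatingField {v : ℝ → Plane → Ω → ℝ}
    (hv : IsMcKeanVlasovSolution P η m lam ε v) (hlam : 0 ≤ lam) (hε : 0 < ε) (hε' : ε < 1 / 2) :
    ∀ᵐ ω ∂P, ∀ t, 0 ≤ t → ∀ x, |v t x ω| ≤ dominatingField η m lam ε t x ω := by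
  filter_upwards [hv.isSpaceTimeRegular, hv.initial, hv.equation] with ω hreg h0 he t ht x
  have hZ := isSpaceTimeRegular_dominatingField η m lam hε ω
  have hα := three_div_log_nonneg hε hε'
  have hg : ∀ (t : ℝ) (x : Plane), 0 ≤ ∫ ω', v t x ω' ^ 2 ∂P := fun t x =>
    integral_nonneg fun _ => sq_nonneg _
  have hZ0 : ∀ t : ℝ, 0 ≤ t → ∀ x : Plane, 0 ≤ dominatingField η m lam ε t x ω :=
    fun t ht x => dominatingField_nonneg η m hlam ht x ω
  have hZe : ∀ t : ℝ, 0 < t → ∀ x : Plane, _ := fun t ht x =>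
    deriv_dominatingField η m lam hε ω ht x
  refine abs_le'.mpr ⟨?_, ?_⟩
  · refine hreg.le_of_potential_nonneg hZ hα hg hZ0 (fun y => ?_) he hZe ht x
    rw [h0, dominatingField_zero η m hlam]
    exact le_abs_self _
  · refine hreg.neg.le_of_potential_nonneg hZ hα hg hZ0 (fun y => ?_) (fun s hs y => ?_) hZe ht x
    · rw [h0, dominatingField_zero η m hlam]
      exact neg_le_abs _
    · rw [IsSpaceTimeRegular.laplacian_neg (fun t x => v t x ω), deriv.fun_neg, he s hs y]
      ring

theorem IsSolution.memLp {v₀ : Plane → Ω → ℝ} {v : ℝ → Plane → Ω → ℝ}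
    (h : IsSolution P m α v₀ v) {t : ℝ} (ht : 0 ≤ t) (x : Plane) : MemLp (v t x) 2 P := by
  refine ⟨(h.aemeasurable t ht x).aestronglyMeasurable, ?_⟩
  rw [eLpNorm_lt_top_iff_lintegral_rpow_enorm_lt_top (by simp) (by simp)]
  simp only [ENNReal.toReal_ofNat, ENNReal.rpow_ofNat]
  -- The horizon `t + 1` is positive even when `t = 0`.
  obtain ⟨C, l, -, -, hb⟩ := (h.moment_growth (t + 1) (by positivity)).exists_le
  exact ((le_iSup₂ (f := fun s (_ : s ∈ Icc (0 : ℝ) (t + 1)) => ∫⁻ ω, ‖v s x ω‖ₑ ^ 2 ∂P) t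
    ⟨ht, by linarith⟩).trans (hb x)).trans_lt ENNReal.ofReal_lt_top

/-- From `V² - U² = (V - U)(V + U)`, bounded by `b Z · 2Z`. The bound on `Z` is a lower Lebesgue
integral, so no measurability of `Z` is required. -/
theorem abs_integral_sq_sub_integral_sq_le {V U Z : Ω → ℝ} (hV : MemLp V 2 P) (hU : MemLp U 2 P)
    {b D : ℝ} (hb : 0 ≤ b) (hD : 0 ≤ D) (hZ : ∫⁻ ω, ‖Z ω‖ₑ ^ 2 ∂P ≤ ENNReal.ofReal D)
    (hVZ : ∀ᵐ ω ∂P, |V ω| ≤ Z ω) (hUZ : ∀ᵐ ω ∂P, |U ω| ≤ Z ω)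
    (hVU : ∀ᵐ ω ∂P, |V ω - U ω| ≤ b * Z ω) :
    |∫ ω, V ω ^ 2 ∂P - ∫ ω, U ω ^ 2 ∂P| ≤ 2 * b * D := by
  rw [← integral_sub hV.integrable_sq hU.integrable_sq]
  have h1 : ‖∫ ω, (V ω ^ 2 - U ω ^ 2) ∂P‖ₑ ≤ ENNReal.ofReal (2 * b * D) := by
    refine (enorm_integral_le_lintegral_enorm _).trans ?_
    rw [ENNReal.ofReal_mul (by positivity)]
    calc ∫⁻ ω, ‖V ω ^ 2 - U ω ^ 2‖ₑ ∂P
        ≤ ∫⁻ ω, ENNReal.ofReal (2 * b) * ‖Z ω‖ₑ ^ 2 ∂P := by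
          refine lintegral_mono_ae ?_
          filter_upwards [hVZ, hUZ, hVU] with ω h1 h2 h3
          rw [Real.enorm_eq_ofReal_abs, Real.enorm_eq_ofReal_abs,
            ← ENNReal.ofReal_pow (abs_nonneg _), sq_abs, ← ENNReal.ofReal_mul (by positivity)]
          refine ENNReal.ofReal_le_ofReal ?_
          have h4 : |V ω + U ω| ≤ 2 * Z ω := (abs_add_le _ _).trans (by linarith)
          have h5 : 0 ≤ Z ω := (abs_nonneg _).trans h1
          calc |V ω ^ 2 - U ω ^ 2| = |V ω - U ω| * |V ω + U ω| := by rw [← abs_mul]; ring_nf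
            _ ≤ (b * Z ω) * (2 * Z ω) := mul_le_mul h3 h4 (abs_nonneg _) (by positivity)
            _ = _ := by ring
      _ ≤ _ := by
          rw [lintegral_const_mul' _ _ ENNReal.ofReal_ne_top]
          gcongr
  rw [Real.enorm_eq_ofReal_abs] at h1
  exact (ENNReal.ofReal_le_ofReal_iff (by positivity)).mp h1

/-- Picard-type iteration. It starts from `|v| + |u| ≤ 2Z`; each round passes through the
expectations and back to the paths, and integrating in time yields the factorial. -/
theorem IsMcKeanVlasovSolution.abs_sub_le [IsProbabilityMeasure P] (hη : IsWhiteNoise P η)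
    {v u : ℝ → Plane → Ω → ℝ} (hv : IsMcKeanVlasovSolution P η m lam ε v)
    (hu : IsMcKeanVlasovSolution P η m lam ε u) (hlam : 0 ≤ lam) (hε : 0 < ε) (hε' : ε < 1 / 2)
    {T D κ : ℝ} (hD : D = (lam * Real.exp (|m| * T)) ^ 2 * heatKernel (ε ^ 2 + ε ^ 2) 0)
    (hκ : κ = 2 * (3 / Real.log (1 / ε)) * D) (n : ℕ) :
    ∀ᵐ ω ∂P, ∀ t, 0 ≤ t → t ≤ T → ∀ x,
      |v t x ω - u t x ω| ≤ 2 * ((κ * t) ^ n / n.factorial) * dominatingField η m lam ε t x ω := by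
  have hα := three_div_log_nonneg hε hε'
  have hk := heatKernel_pos (show 0 < ε ^ 2 + ε ^ 2 by positivity) 0
  have hD0 : 0 ≤ D := by rw [hD]; positivity
  have hκ0 : 0 ≤ κ := by rw [hκ]; positivity
  have hvZ := hv.abs_le_dominatingField hlam hε hε'
  have huZ := hu.abs_le_dominatingField hlam hε hε'
  induction n with
  | zero =>
    filter_upwards [hvZ, huZ] with ω h1 h2 t ht _ x
    have h3 := h1 t ht x
    have h4 := h2 t ht x
    simp only [pow_zero, Nat.factorial_zero, Nat.cast_one, div_one, mul_one]
    exact (abs_sub _ _).trans (by linarith)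
  | succ n ih =>
    have hγ : 0 ≤ 2 * (2 * (κ ^ n / n.factorial)) * D := by positivity
    -- Taking expectations turns the almost sure bound into a deterministic one for all `s` and `x`,
    -- so the next pathwise comparison needs no uncountable union of null sets.
    have hclose : ∀ s, 0 < s → s ≤ T → ∀ x,
        |∫ ω, v s x ω ^ 2 ∂P - ∫ ω, u s x ω ^ 2 ∂P| ≤
          2 * (2 * (κ ^ n / n.factorial)) * D * s ^ n := fun s hs hsT x => by
      have h1 := abs_integral_sq_sub_integral_sq_le (hv.memLp hs.le x) (hu.memLp hs.le x)
        (Z := dominatingField η m lam ε s x) (b := 2 * ((κ * s) ^ n / n.factorial))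
        (by positivity) hD0 (hD ▸ hη.lintegral_dominatingField_le m hlam hε hs.le hsT x)
        (hvZ.mono fun ω h => h s hs.le x) (huZ.mono fun ω h => h s hs.le x)
        (ih.mono fun ω h => h s hs.le hsT x)
      refine h1.trans_eq ?_
      rw [mul_pow]
      ring
    filter_upwards [hv.isSpaceTimeRegular, hu.isSpaceTimeRegular, hv.initial, hu.initial,
      hv.equation, hu.equation, hvZ, huZ] with ω rv ru iv iu ev eu bv bu t ht htT x
    have hZ := isSpaceTimeRegular_dominatingField η m lam hε ω
    have hZ0 : ∀ t : ℝ, 0 ≤ t → ∀ x : Plane, 0 ≤ dominatingField η m lam ε t x ω :=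
      fun t ht x => dominatingField_nonneg η m hlam ht x ω
    have hZe : ∀ t : ℝ, 0 < t → ∀ x : Plane, _ := fun t ht x =>
      deriv_dominatingField η m lam hε ω ht x
    have hcoef : 3 / Real.log (1 / ε) * (2 * (2 * (κ ^ n / n.factorial)) * D) * t ^ (n + 1) /
        (n + 1) = 2 * ((κ * t) ^ (n + 1) / (n + 1).factorial) := by
      rw [mul_pow, pow_succ κ]
      -- Only the additional factor `κ` of the new power is unfolded.
      nth_rw 3 [hκ]
      rw [Nat.factorial_succ]
      push_cast
      field_simp
    have hgv : ∀ (t : ℝ) (x : Plane), 0 ≤ ∫ ω', v t x ω' ^ 2 ∂P := fun t x =>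
      integral_nonneg fun _ => sq_nonneg _
    have hgu : ∀ (t : ℝ) (x : Plane), 0 ≤ ∫ ω', u t x ω' ^ 2 ∂P := fun t x =>
      integral_nonneg fun _ => sq_nonneg _
    rw [← hcoef]
    refine abs_le'.mpr ⟨?_, ?_⟩
    · exact rv.sub_le_of_potential_close ru hZ hα hgv hZ0 (fun y => by rw [iv, iu]) ev eu hZe
        (fun s hs y => bu s hs.le y) ht hγ n
        (fun s hs hst y => hclose s hs (hst.trans htT) y) x
    · rw [neg_sub]
      exact ru.sub_le_of_potential_close rv hZ hα hgu hZ0 (fun y => by rw [iv, iu]) eu ev hZe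
        (fun s hs y => bv s hs.le y) ht hγ n
        (fun s hs hst y => by
          rw [abs_sub_comm]
          exact hclose s hs (hst.trans htT) y) x

/-- One null set serves all integer horizons `N` and all iterates `n`; then `n → ∞` on each path. -/
theorem IsMcKeanVlasovSolution.ae_eq [IsProbabilityMeasure P] (hη : IsWhiteNoise P η)
    {v u : ℝ → Plane → Ω → ℝ} (hv : IsMcKeanVlasovSolution P η m lam ε v)
    (hu : IsMcKeanVlasovSolution P η m lam ε u) (hlam : 0 ≤ lam) (hε : 0 < ε) (hε' : ε < 1 / 2) :
    ∀ᵐ ω ∂P, ∀ t, 0 ≤ t → ∀ x, v t x ω = u t x ω := by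
  have h1 : ∀ᵐ ω ∂P, ∀ N n : ℕ, _ := ae_all_iff.mpr fun N => ae_all_iff.mpr fun n =>
    hv.abs_sub_le hη hu hlam hε hε' (T := (N : ℝ)) rfl rfl n
  filter_upwards [h1] with ω hω t ht x
  obtain ⟨N, hN⟩ := exists_nat_ge t
  have hlim := ((FloorSemiring.tendsto_pow_div_factorial_atTop (2 * (3 / Real.log (1 / ε)) *
    ((lam * Real.exp (|m| * N)) ^ 2 * heatKernel (ε ^ 2 + ε ^ 2) 0) * t)).const_mul 2).mul_const
    (dominatingField η m lam ε t x ω)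
  rw [mul_zero, zero_mul] at hlim
  have h2 := ge_of_tendsto' hlim fun n => hω N n t ht hN x
  exact sub_eq_zero.mp (abs_nonpos_iff.mp h2)

end Uniqueness

/-! ### The limit of the solutions -/

theorem abs_exp_sub_one_le_mul_exp (u : ℝ) : |Real.exp u - 1| ≤ |u| * Real.exp |u| := by
  have h1 := Real.add_one_le_exp u
  have h2 : Real.exp u - 1 ≤ u * Real.exp u := by
    have h3 := mul_le_mul_of_nonneg_right (Real.add_one_le_exp (-u)) (Real.exp_pos u).le
    rw [← Real.exp_add, neg_add_cancel, Real.exp_zero] at h3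
    linarith
  refine abs_le.mpr ⟨?_, ?_⟩
  · have h4 : |u| * 1 ≤ |u| * Real.exp |u| := by
      gcongr
      exact Real.one_le_exp (abs_nonneg u)
    linarith [neg_abs_le u]
  · refine h2.trans (mul_le_mul (le_abs_self u) (Real.exp_le_exp.mpr (le_abs_self u))
      (Real.exp_pos _).le (abs_nonneg u))

/-- The logarithm from `∫ ds/(s+ε²)` supplies exactly the normalisation `2 log(1/ε)`. The remainder
stays bounded because `|e^{2ms} - 1|` is at most a constant times `s ≤ s + ε²`. -/
theorem abs_cEps_sub_one_le (m : ℝ) {ε t : ℝ} (hε : 0 < ε) (hε' : ε < 1 / 2) (ht : 0 < t) :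
    |cEps m ε t - 1| ≤ (|Real.log (t + ε ^ 2)| + 2 * |m| * Real.exp (2 * |m| * t) * t) /
      (2 * Real.log (1 / ε)) := by
  have hL := log_one_div_pos hε hε'
  have hε2 : 0 < ε ^ 2 := by positivity
  have hlog : ∫ s in (0 : ℝ)..t, 1 / (s + ε ^ 2) = Real.log (t + ε ^ 2) + 2 * Real.log (1 / ε) := by
    rw [intervalIntegral.integral_comp_add_right (fun s : ℝ => 1 / s) (ε ^ 2),
      integral_one_div_of_pos (by simpa using hε2) (by positivity), zero_add,
      Real.log_div (by positivity) hε2.ne', Real.log_pow, one_div, Real.log_inv]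
    push_cast
    ring
  have i1 : IntervalIntegrable (fun s : ℝ => Real.exp (2 * m * s) / (s + ε ^ 2)) volume 0 t :=
    intervalIntegrable_cEps_integrand m hε (by linarith)
  have i0 : IntervalIntegrable (fun s : ℝ => 1 / (s + ε ^ 2)) volume 0 t := by
    simpa using intervalIntegrable_cEps_integrand 0 hε (t := t) (by linarith)
  set R := ∫ s in (0 : ℝ)..t, (Real.exp (2 * m * s) / (s + ε ^ 2) - 1 / (s + ε ^ 2)) with hR
  have hsplit : ∫ s in (0 : ℝ)..t, Real.exp (2 * m * s) / (s + ε ^ 2) =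
      Real.log (t + ε ^ 2) + 2 * Real.log (1 / ε) + R := by
    rw [hR, intervalIntegral.integral_sub i1 i0, hlog]
    ring
  have hRb : |R| ≤ 2 * |m| * Real.exp (2 * |m| * t) * t := by
    have := intervalIntegral.norm_integral_le_of_norm_le_const (a := (0 : ℝ)) (b := t)
      (f := fun s : ℝ => Real.exp (2 * m * s) / (s + ε ^ 2) - 1 / (s + ε ^ 2))
      (C := 2 * |m| * Real.exp (2 * |m| * t)) fun s hs => by
        rw [uIoc_of_le ht.le] at hs
        have hs0 : 0 < s := hs.1
        rw [← sub_div, Real.norm_eq_abs, abs_div, abs_of_pos (show 0 < s + ε ^ 2 by positivity),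
          div_le_iff₀ (by positivity)]
        refine (abs_exp_sub_one_le_mul_exp _).trans ?_
        have h1 : |2 * m * s| = 2 * |m| * s := by
          rw [abs_mul, abs_mul, abs_of_pos hs0, abs_two]
        rw [h1]
        calc 2 * |m| * s * Real.exp (2 * |m| * s)
            ≤ 2 * |m| * (s + ε ^ 2) * Real.exp (2 * |m| * t) := by
              gcongr
              · linarith
              · exact hs.2
          _ = _ := by ring
    rwa [sub_zero, abs_of_pos ht, Real.norm_eq_abs] at this
  have hc : cEps m ε t - 1 = (Real.log (t + ε ^ 2) + R) / (2 * Real.log (1 / ε)) := by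
    rw [cEps, hsplit]
    field_simp
    ring
  rw [hc, abs_div, abs_of_pos (show 0 < 2 * Real.log (1 / ε) by positivity)]
  gcongr
  exact (abs_add_le _ _).trans (by linarith)

theorem eventually_pos_lt_half : ∀ᶠ ε : ℝ in 𝓝[>] 0, 0 < ε ∧ ε < 1 / 2 :=
  Ioo_mem_nhdsGT (by norm_num)

theorem tendsto_cEps (m : ℝ) {t : ℝ} (ht : 0 < t) :
    Tendsto (fun ε => cEps m ε t) (𝓝[>] 0) (𝓝 1) := by
  rw [tendsto_iff_norm_sub_tendsto_zero]
  have hden : Tendsto (fun ε : ℝ => 2 * Real.log (1 / ε)) (𝓝[>] 0) atTop := by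
    refine Tendsto.const_mul_atTop two_pos (Real.tendsto_log_atTop.comp ?_)
    exact tendsto_inv_nhdsGT_zero.congr fun ε : ℝ => (one_div ε).symm
  have hnum : Tendsto
      (fun ε : ℝ => |Real.log (t + ε ^ 2)| + 2 * |m| * Real.exp (2 * |m| * t) * t) (𝓝[>] 0)
      (𝓝 (|Real.log (t + 0 ^ 2)| + 2 * |m| * Real.exp (2 * |m| * t) * t)) := by
    have : ContinuousAt
        (fun ε : ℝ => |Real.log (t + ε ^ 2)| + 2 * |m| * Real.exp (2 * |m| * t) * t) 0 := by
      have h1 : ContinuousAt (fun ε : ℝ => t + ε ^ 2) 0 := by fun_prop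
      exact (h1.log (by simpa using ht.ne')).abs.add continuousAt_const
    exact this.tendsto.mono_left nhdsWithin_le_nhds
  refine squeeze_zero' (Eventually.of_forall fun ε => norm_nonneg _) ?_ (hnum.div_atTop hden)
  filter_upwards [eventually_pos_lt_half] with ε hε using abs_cEps_sub_one_le m hε.1 hε.2 ht

theorem tendsto_amplitude (m lam : ℝ) {t : ℝ} (ht : 0 < t) :
    Tendsto (fun ε => amplitude m lam ε t) (𝓝[>] 0)
      (𝓝 (lam * sigma (lam ^ 2) * Real.exp (m * t))) := by
  have h1 : Tendsto (fun ε => 1 + 3 * lam ^ 2 / π * cEps m ε t) (𝓝[>] 0)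
      (𝓝 (1 + 3 / π * lam ^ 2)) := by
    convert ((tendsto_cEps m ht).const_mul (3 * lam ^ 2 / π)).const_add 1 using 2
    ring
  have h2 : Tendsto (fun ε => sigmaEps m lam ε t) (𝓝[>] 0) (𝓝 (sigma (lam ^ 2))) :=
    tendsto_const_nhds.div h1.sqrt (Real.sqrt_pos.mpr (by positivity)).ne'
  exact (h2.const_mul lam).mul_const _

section MeanSquare

variable {Ω : Type*} [MeasurableSpace Ω] {P : Measure Ω} {η : Ω → (𝓢(Plane, ℝ) →L[ℝ] ℝ)}

theorem IsWhiteNoise.lintegral_heatConv_sub (hη : IsWhiteNoise P η) {a b : ℝ} (ha : 0 < a)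
    (hb : 0 < b) (A B : ℝ) (x : Plane) :
    ∫⁻ ω, ‖A * heatConv (η ω) a x - B * heatConv (η ω) b x‖ₑ ^ 2 ∂P =
      ENNReal.ofReal (A ^ 2 * heatKernel (a + a) 0 - 2 * (A * B) * heatKernel (a + b) 0 +
        B ^ 2 * heatKernel (b + b) 0) := by
  have hA := hη.memLp_heatConv ha x
  have hB := hη.memLp_heatConv hb x
  have hAB : Integrable (fun ω => heatConv (η ω) a x * heatConv (η ω) b x) P :=
    hA.integrable_mul hB
  have hm : MemLp (fun ω => A * heatConv (η ω) a x - B * heatConv (η ω) b x) 2 P :=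
    (hA.const_mul A).sub (hB.const_mul B)
  rw [lintegral_enorm_sq_eq hm]
  have h1 : ∀ ω, (A * heatConv (η ω) a x - B * heatConv (η ω) b x) ^ 2 =
      A ^ 2 * heatConv (η ω) a x ^ 2 - 2 * (A * B) * (heatConv (η ω) a x * heatConv (η ω) b x) +
        B ^ 2 * heatConv (η ω) b x ^ 2 := fun ω => by ring
  simp_rw [h1]
  have i1 : Integrable (fun ω => A ^ 2 * heatConv (η ω) a x ^ 2 -
      2 * (A * B) * (heatConv (η ω) a x * heatConv (η ω) b x)) P :=
    (hA.integrable_sq.const_mul _).sub (hAB.const_mul _)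
  rw [integral_add i1 (hB.integrable_sq.const_mul _),
    integral_sub (hA.integrable_sq.const_mul _) (hAB.const_mul _), integral_const_mul,
    integral_const_mul, integral_const_mul, hη.integral_heatConv_sq ha, hη.integral_heatConv_sq hb,
    hη.integral_heatConv_mul ha hb, sub_self]

/-- Uniqueness replaces `V ε` by the explicit field, and the semigroup property replaces that by a
multiple of `p_{t+ε²} ⋆ η`. The error then depends only on heat kernels at the origin. -/
theorem IsWhiteNoise.tendsto_lintegral_sub [IsProbabilityMeasure P] (hη : IsWhiteNoise P η)
    (m : ℝ) {lam : ℝ} (hlam : 0 ≤ lam) {V : ℝ → ℝ → Plane → Ω → ℝ}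
    (hV : ∀ ε : ℝ, 0 < ε → ε < 1 / 2 → IsMcKeanVlasovSolution P η m lam ε (V ε))
    {t : ℝ} (ht : 0 < t) (x : Plane) :
    Tendsto (fun ε : ℝ => ∫⁻ ω, ‖V ε t x ω -
        lam * sigma (lam ^ 2) * Real.exp (m * t) * heatConv (η ω) t x‖ₑ ^ 2 ∂P)
      (𝓝[>] 0) (𝓝 0) := by
  set B := lam * sigma (lam ^ 2) * Real.exp (m * t) with hB
  have hk : ∀ c d : ℝ, 0 < c → Tendsto (fun ε : ℝ => heatKernel (c + d * ε ^ 2) 0) (𝓝[>] 0)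
      (𝓝 (heatKernel c 0)) := fun c d hc => by
    have h1 : ContinuousAt (fun ε : ℝ => heatKernel (c + d * ε ^ 2) 0) 0 := by
      simp only [heatKernel_zero]
      refine ContinuousAt.div (by fun_prop) (by fun_prop) ?_
      simp only [ne_eq, OfNat.ofNat_ne_zero, not_false_eq_true, zero_pow, mul_zero, add_zero]
      positivity
    have h2 := h1.tendsto.mono_left (nhdsWithin_le_nhds (s := Ioi 0))
    simpa using h2
  have hA := tendsto_amplitude m lam ht
  rw [← hB] at hA
  -- As the amplitude tends to `B`, the three terms tend to `B²`, `-2B²` and `B²` times `p_{2t}(0)`.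
  have hlim : Tendsto (fun ε : ℝ => ENNReal.ofReal
      (amplitude m lam ε t ^ 2 * heatKernel (2 * t + 2 * ε ^ 2) 0 -
        2 * (amplitude m lam ε t * B) * heatKernel (2 * t + 1 * ε ^ 2) 0 +
        B ^ 2 * heatKernel (2 * t) 0)) (𝓝[>] 0) (𝓝 0) := by
    have h2t : 0 < 2 * t := by positivity
    have h := ((((hA.pow 2).mul (hk (2 * t) 2 h2t)).sub
      (((hA.mul_const B).const_mul 2).mul (hk (2 * t) 1 h2t))).add_const
      (B ^ 2 * heatKernel (2 * t) 0))
    rw [show B ^ 2 * heatKernel (2 * t) 0 - 2 * (B * B) * heatKernel (2 * t) 0 +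
      B ^ 2 * heatKernel (2 * t) 0 = 0 by ring] at h
    simpa only [ENNReal.ofReal_zero] using ENNReal.tendsto_ofReal h
  refine hlim.congr' ?_
  filter_upwards [eventually_pos_lt_half] with ε hε
  have hε2 : 0 < ε ^ 2 := pow_pos hε.1 2
  have huniq := (hV ε hε.1 hε.2).ae_eq hη
    (hη.isMcKeanVlasovSolution_explicitSolution m lam hε.1 hε.2) hlam hε.1 hε.2
  have h1 : ∫⁻ ω, ‖V ε t x ω - B * heatConv (η ω) t x‖ₑ ^ 2 ∂P =
      ∫⁻ ω, ‖amplitude m lam ε t * heatConv (η ω) (t + ε ^ 2) x - B * heatConv (η ω) t x‖ₑ ^ 2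
        ∂P := by
    refine lintegral_congr_ae ?_
    filter_upwards [huniq, hη.explicitSolution_ae_eq m lam hε.1 ht.le x] with ω h2 h3
    rw [h2 t ht.le x, h3]
  rw [h1, hη.lintegral_heatConv_sub (by positivity) ht]
  ring_nf

end MeanSquare

end MeanFieldAllenCahn

end
open MeanFieldAllenCahn in
theorem proposition1p2 {Ω : Type*} [MeasurableSpace Ω] (P : Measure Ω) [IsProbabilityMeasure P]
    (η : Ω → (𝓢(Plane, ℝ) →L[ℝ] ℝ)) (hη : IsWhiteNoise P η)
    (m lam : ℝ) (hlam : 0 < lam) :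
    -- existence, with the explicit solution, and uniqueness up to indistinguishability
    (∀ ε : ℝ, 0 < ε → ε < 1 / 2 →
      IsMcKeanVlasovSolution P η m lam ε (explicitSolution η m lam ε) ∧
      ∀ v : ℝ → Plane → Ω → ℝ, IsMcKeanVlasovSolution P η m lam ε v →
        ∀ᵐ ω ∂P, ∀ t : ℝ, 0 ≤ t → ∀ x : Plane, v t x ω = explicitSolution η m lam ε t x ω) ∧
    -- `sigma` solves the limiting ordinary differential equation
    (sigma 0 = 1 ∧
      ∀ ζ : ℝ, 0 ≤ ζ → HasDerivAt sigma (-(3 / (2 * Real.pi)) * sigma ζ ^ 3) ζ) ∧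
    -- convergence in mean square of the solutions as `ε → 0`
    (∀ V : ℝ → ℝ → Plane → Ω → ℝ,
      (∀ ε : ℝ, 0 < ε → ε < 1 / 2 → IsMcKeanVlasovSolution P η m lam ε (V ε)) →
      ∀ t : ℝ, 0 < t → ∀ x : Plane,
        Tendsto (fun ε : ℝ => ∫⁻ ω, ‖V ε t x ω -
            lam * sigma (lam ^ 2) * Real.exp (m * t) * heatConv (η ω) t x‖ₑ ^ 2 ∂P)
          (𝓝[>] 0) (𝓝 0)) := by
  refine ⟨fun ε hε hε' => ?_, ⟨sigma_zero, fun ζ hζ => hasDerivAt_sigma hζ⟩,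
    fun V hV t ht x => hη.tendsto_lintegral_sub m hlam.le hV ht x⟩
  have hsol := hη.isMcKeanVlasovSolution_explicitSolution m lam hε hε'
  exact ⟨hsol, fun v hv => hv.ae_eq hη hsol hlam.le hε hε'⟩
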